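/- Let $n\in\{2,3,4,6\}$, let $A$ be a divisor of $n$ with $\gcd(n/A,A)=1$ and $A\neq n$, and let $\rho:C_n\hookrightarrow SL_2(\mathbb{Z})$ be an injective homomorphism from the cyclic group $C_n=\mathbb{Z}/n$ (an integral representation of $C_n$ by rotations of a plane lattice). Let $\Lambda=\mathbb{Z}t_1\oplus\mathbb{Z}^2$ be the $C_n$-module on which $C_n$ acts trivially on $\mathbb{Z}t_1$ (the screw axis) and by $\rho$ on $\mathbb{Z}^2$. The extension classes in $H^2(C_n,\mathbb{Z}t_1)\cong\mathbb{Z}/n$ that become trivial on the subgroup $C_A\subseteq C_n$ are the multiples of $A$, and form a group $\cong\mathbb{Z}/\frac nA$; for $\nu\in\mathbb{Z}/\frac nA$ let $$1\to\Lambda\to P_{A;\nu}\to C_n\to 1$$ be the extension with class $A\nu\in\mathbb{Z}/n$. Explicitly, a lift $\hat g$ of the standard generator of $C_n$ satisfies $\hat g^{\,n}=A\nu\,t_1$. Thus $P_{A;\nu}$ is a three-dimensional space group with point group $C_n$, and it is non-symmorphic for $\nu=1$, because $A\neq n$. Let $P=P_{A;1}$. All cohomology is group cohomology with coefficients in the trivial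 module $\mathbb{Z}$. Then $$H^3(P,\mathbb{Z})\;\cong\;\tfrac nA\mathbb{Z}\;\oplus\;\mathbb{Z}/A .$$ Here the summand $\frac nA\mathbb{Z}$ is the image of the restriction map to the lattice: there are isomorphisms $\varphi:H^3(P,\mathbb{Z})\to\frac nA\mathbb{Z}\oplus\mathbb{Z}/A$ and $\psi:H^3(\Lambda,\mathbb{Z})\to\mathbb{Z}$ such that $\psi\circ\mathrm{res}^P_\Lambda$ is $\varphi$ followed by the projection to $\frac nA\mathbb{Z}\subseteq\mathbb{Z}$. In particular, if $A=1$, then $H^3(P,\mathbb{Z})\cong n\mathbb{Z}$ (so $3\mathbb{Z}$ for $n=3$), and $\mathrm{res}^P_\Lambda$ is identified with the inclusion $n\mathbb{Z}\subseteq\mathbb{Z}$. -/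

import Mathlib

/-- The number of carries (`0` or `1`) when the residues `a` and `b` modulo `n` are added:
`carry n a b = 1` if the representatives in `{0, …, n - 1}` add up to at least `n`, and `0` if not.
This is the standard 2-cocycle of the extension `0 → ℤ → ℤ → ℤ/n → 0`, and its class generates
`H²(C_n, ℤ) ≅ ℤ/n` (trivial action). -/
def carry (n : ℕ) (a b : ZMod n) : ℤ := (((a.val + b.val) / n : ℕ) : ℤ)

theorem carry_cocycle (n : ℕ) [NeZero n] (a b c : ZMod n) :
    carry n a b + carry n (a + b) c = carry n b c + carry n a (b + c) := by
  have hn : (n : ℤ) ≠ 0 := by exact_mod_cast NeZero.ne n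
  have key : ∀ x y : ZMod n, (n : ℤ) * carry n x y = x.val + y.val - (x + y).val := by
    intro x y
    have h := Nat.div_add_mod (x.val + y.val) n
    rw [← ZMod.val_add] at h
    have h' : (n : ℤ) * carry n x y + ((x + y).val : ℤ) = x.val + y.val := by
      unfold carry
      exact_mod_cast h
    linarith
  apply mul_left_cancel₀ hn
  rw [mul_add, mul_add, key, key, key, key, add_assoc a b c]
  ring

theorem carry_zero_left (n : ℕ) [NeZero n] (a : ZMod n) : carry n 0 a = 0 := by
  simp [carry, Nat.div_eq_of_lt (ZMod.val_lt a)]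

theorem carry_zero_right (n : ℕ) [NeZero n] (a : ZMod n) : carry n a 0 = 0 := by
  simp [carry, Nat.div_eq_of_lt (ZMod.val_lt a)]

theorem carry_comm (n : ℕ) (a b : ZMod n) : carry n a b = carry n b a := by
  simp [carry, Nat.add_comm]

/-- The screw space group `P_{A;ν}` with point group `1 × C_n`, written as a twisted product
`Λ × C_n`, where `Λ = ℤ t₁ ⊕ ℤ²` is the translation lattice.  An element `(z, v, a)` stands for
`(z t₁ + v) · â`, where `â` is a fixed lift of `a ∈ C_n = ℤ/n`.  The point group acts trivially on
the screw axis `ℤ t₁` and by the integral representation `ρ` on the plane `ℤ²`.  See the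
multiplication below for the extension class. -/
@[ext]
structure ScrewGroup (n A : ℕ) (ν : ZMod (n / A))
    (ρ : Multiplicative (ZMod n) →* Matrix.SpecialLinearGroup (Fin 2) ℤ) where
  /-- the translation along the screw axis -/
  axis : ℤ
  /-- the translation in the plane -/
  plane : Fin 2 → ℤ
  /-- the image in the point group -/
  rot : ZMod n

namespace ScrewGroup

variable {n A : ℕ} {ν : ZMod (n / A)}
  {ρ : Multiplicative (ZMod n) →* Matrix.SpecialLinearGroup (Fin 2) ℤ}

/-- The action of `a ∈ C_n` on the plane lattice. -/
def act (ρ : Multiplicative (ZMod n) →* Matrix.SpecialLinearGroup (Fin 2) ℤ) (a : ZMod n)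
    (v : Fin 2 → ℤ) : Fin 2 → ℤ :=
  Matrix.mulVec (ρ (Multiplicative.ofAdd a)).1 v

theorem act_zero (v : Fin 2 → ℤ) : act ρ 0 v = v := by
  simp [act]

theorem act_add (a b : ZMod n) (v : Fin 2 → ℤ) : act ρ (a + b) v = act ρ a (act ρ b v) := by
  simp only [act, ofAdd_add, map_mul, Matrix.SpecialLinearGroup.coe_mul, Matrix.mulVec_mulVec]

theorem act_vadd (a : ZMod n) (v w : Fin 2 → ℤ) :
    act ρ a (v + w) = act ρ a v + act ρ a w := by
  simp [act, Matrix.mulVec_add]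

theorem act_neg (a : ZMod n) (v : Fin 2 → ℤ) : act ρ a (-v) = -act ρ a v := by
  simp [act, Matrix.mulVec_neg]

/-- `(λ â) (μ b̂) = (λ + a • μ + c(a, b)) (a+b)^` with the 2-cocycle
`c(a, b) = carry(a, b) • A ν t₁`.  Since the class of `carry` generates `H²(C_n, ℤ t₁) ≅ ℤ/n`, the
classes of these cocycles are exactly the multiples of `A` in `ℤ/n`, that is, the classes that
become trivial on the subgroup `C_A ⊆ C_n`; they form a cyclic group `ℤ/(n/A)`, in which `ν`
lives.  The lift `ĝ` of the generator satisfies `ĝ ^ n = A ν t₁` (the screw `n_A` if `ν = 1`). -/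
instance : Mul (ScrewGroup n A ν ρ) where
  mul x y :=
    { axis := x.axis + y.axis + carry n x.rot y.rot * (A * ν.val)
      plane := x.plane + act ρ x.rot y.plane
      rot := x.rot + y.rot }

instance : One (ScrewGroup n A ν ρ) where
  one := { axis := 0, plane := 0, rot := 0 }

instance : Inv (ScrewGroup n A ν ρ) where
  inv x :=
    { axis := -x.axis - carry n (-x.rot) x.rot * (A * ν.val)
      plane := -act ρ (-x.rot) x.plane
      rot := -x.rot }

theorem mul_def (x y : ScrewGroup n A ν ρ) :
    x * y =
      { axis := x.axis + y.axis + carry n x.rot y.rot * (A * ν.val)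
        plane := x.plane + act ρ x.rot y.plane
        rot := x.rot + y.rot } := rfl

theorem one_def : (1 : ScrewGroup n A ν ρ) = { axis := 0, plane := 0, rot := 0 } := rfl

theorem inv_def (x : ScrewGroup n A ν ρ) :
    x⁻¹ =
      { axis := -x.axis - carry n (-x.rot) x.rot * (A * ν.val)
        plane := -act ρ (-x.rot) x.plane
        rot := -x.rot } := rfl

instance [NeZero n] : Group (ScrewGroup n A ν ρ) :=
  Group.ofLeftAxioms
    (by
      intro x y z
      simp only [mul_def]
      ext1
      · have h := carry_cocycle n x.rot y.rot z.rot
        simp only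
        linear_combination ((A : ℤ) * (ν.val : ℤ)) * h
      · simp only [act_vadd, act_add, add_assoc]
      · simp only [add_assoc])
    (by
      intro x
      simp only [mul_def, one_def, carry_zero_left, act_zero, zero_add, zero_mul, add_zero])
    (by
      intro x
      simp only [mul_def, one_def, inv_def]
      ext1
      · simp only
        ring
      · simp only
        exact neg_add_cancel _
      · simp only
        exact neg_add_cancel _)

variable (n A ν ρ) in
/-- The inclusion of the translation lattice `Λ = ℤ t₁ ⊕ ℤ²` into `P_{A;ν}`. -/
def translation [NeZero n] :
    Multiplicative (ℤ × (Fin 2 → ℤ)) →* ScrewGroup n A ν ρ where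
  toFun t := { axis := t.toAdd.1, plane := t.toAdd.2, rot := 0 }
  map_one' := rfl
  map_mul' s t := by
    simp [mul_def, carry_zero_left, act_zero]

end ScrewGroup

/-- Group cohomology `Hᵏ(G, ℤ)` with coefficients in the trivial `G`-module `ℤ`. -/
noncomputable abbrev integralCohomology (G : Type) [Group G] (k : ℕ) : ModuleCat ℤ :=
  groupCohomology (Rep.trivial ℤ G ℤ) k

/-- The pullback `Hᵏ(G, ℤ) → Hᵏ(H, ℤ)` along a group homomorphism `f : H → G` (the restriction map
if `f` is the inclusion of a subgroup). -/
noncomputable def integralCohomologyMap {G H : Type} [Group G] [Group H] (f : H →* G) (k : ℕ) :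
    integralCohomology G k →ₗ[ℤ] integralCohomology H k :=
  (groupCohomology.map (A := Rep.trivial ℤ G ℤ) (B := Rep.trivial ℤ H ℤ) f
    (CategoryTheory.CategoryStruct.id (Rep.trivial ℤ H ℤ)) k).hom

/-! Let `T = ℤ²` be the plane translations and `E` the abelian group of motions along the axis, so
that `P = T ⋊ E`. Measuring motion along the axis maps `E` onto `ℤ` with cyclic kernel of order `A`;
the smallest screw goes to `1` and `t₁` to `n/A`.

In the Lyndon–Hochschild–Serre picture, `H³(P)` is built from `H³(E, ℤ) ≅ ℤ/A`, `H²(E, H¹(T))` and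
`H¹(E, H²(T))`. The first splits off because `P → E` has a section. The groups `Hᵏ(E, H¹(T))` vanish
for `k = 2, 3`: if `A = 1`, then `E` is infinite cyclic; otherwise `n = 6`, and a central `c`
satisfies `c² - c + 1 = 0` on `H¹(T)` but acts as the identity on cohomology. Determinant one makes
`E` act trivially on `H²(T) ≅ ℤ`, so the third term is `Hom(E, ℤ) ≅ ℤ`. Restriction to `Λ` restricts
a homomorphism from `E` to `ℤ t₁`, whence the factor `n/A`, and kills the torsion.

Dimension shifting replaces the spectral sequence. Let `J` be the functions on `ℤ²` modulo
constants, `I` the functions from a free `P`-set to `J`, and `X = I/J`. Shapiro's lemma for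
functions on `ℤ²` gives `H³(P) = H¹(P, X) ⊕ H³(E)` (`bijective_doubleDelta_add_inflation`). A class
in `H¹(P, X)` is represented by a crossed homomorphism that vanishes on `T`, that is, one from `E`
to `Xᵀ`. The exact sequence `0 → Jᵀ → Iᵀ → Xᵀ → ℤ → 0`, whose last map `lam` is a discrete curl,
then leads to `Hom(E, ℤ)` (`bijective_coeffMap_lamFixed`, `bijective_lamAt`). The same modules serve
for `Λ`, so restriction can be followed through (`IsRestriction.exists_equiv`). -/

namespace ScrewCohomology

open CategoryTheory Representation

/-! ### Functoriality in the group and in the coefficients -/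

section Functoriality

variable {R G H K V W U : Type} [CommRing R] [Group G] [Group H] [Group K] [AddCommGroup V]
  [Module R V]
  [AddCommGroup W] [Module R W] [AddCommGroup U] [Module R U]

/-- Group cohomology of an unbundled representation. -/
noncomputable abbrev coh (ρ : Representation R G V) (n : ℕ) : ModuleCat R :=
  groupCohomology (Rep.of ρ) n

/-- The map on cohomology induced by a group homomorphism and an equivariant map. -/
noncomputable def cohMap {ρ : Representation R G V} {σ : Representation R H W} (f : H →* G)
    (φ : IntertwiningMap (ρ.comp f) σ) (n : ℕ) : coh ρ n →ₗ[R] coh σ n :=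
  (groupCohomology.map (A := Rep.of ρ) (B := Rep.of σ) f (Rep.ofHom φ) n).hom

/-- The map on cohomology induced by an equivariant map of coefficients. -/
noncomputable abbrev coeffMap {ρ : Representation R G V} {σ : Representation R G W}
    (φ : IntertwiningMap ρ σ) (n : ℕ) : coh ρ n →ₗ[R] coh σ n :=
  cohMap (MonoidHom.id G) φ n

theorem cohMap_id (ρ : Representation R G V) (n : ℕ) (x : coh ρ n) :
    cohMap (MonoidHom.id G) (IntertwiningMap.id ρ) n x = x := by
  have h := groupCohomology.map_id (B := Rep.of ρ) n
  exact congr($(h) x)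

theorem cohMap_comp {ρ : Representation R G V} {σ : Representation R H W}
    {τ : Representation R K U} (f : H →* G) (g : K →* H)
    (φ : IntertwiningMap (ρ.comp f) σ) (ψ : IntertwiningMap (σ.comp g) τ)
    (χ : IntertwiningMap (ρ.comp (f.comp g)) τ) (hχ : ∀ v, χ v = ψ (φ v)) (n : ℕ)
    (x : coh ρ n) :
    cohMap g ψ n (cohMap f φ n x) = cohMap (f.comp g) χ n x := by
  have h := groupCohomology.map_comp (A := Rep.of ρ) (B := Rep.of σ) (C := Rep.of τ) f g
    (Rep.ofHom φ) (Rep.ofHom ψ) n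
  have h2 : groupCohomology.map (A := Rep.of ρ) (B := Rep.of τ) (f.comp g) (Rep.ofHom χ) n =
      groupCohomology.map (f.comp g) ((Rep.resFunctor g).map (Rep.ofHom φ) ≫ Rep.ofHom ψ) n :=
    groupCohomology.map_congr rfl (by ext v; exact hχ v) n
  exact congr($(h.symm.trans h2.symm) x)

theorem cohMap_congr {ρ : Representation R G V} {σ : Representation R H W} {f g : H →* G}
    (hfg : f = g) (φ : IntertwiningMap (ρ.comp f) σ) (ψ : IntertwiningMap (ρ.comp g) σ)
    (h : ∀ v, φ v = ψ v) (n : ℕ) : cohMap f φ n = cohMap g ψ n := by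
  have h2 : groupCohomology.map (A := Rep.of ρ) (B := Rep.of σ) f (Rep.ofHom φ) n =
      groupCohomology.map (A := Rep.of ρ) (B := Rep.of σ) g (Rep.ofHom ψ) n :=
    groupCohomology.map_congr hfg (by ext v; exact h v) n
  exact congr(ModuleCat.Hom.hom $h2)

theorem coeffMap_add {ρ : Representation R G V} {σ : Representation R G W}
    (φ ψ : IntertwiningMap ρ σ) (n : ℕ) (x : coh ρ n) :
    coeffMap (φ + ψ) n x = coeffMap φ n x + coeffMap ψ n x := by
  have h : groupCohomology.cochainsMap (A := Rep.of ρ) (B := Rep.of σ) (MonoidHom.id G)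
      (Rep.ofHom (φ + ψ)) = groupCohomology.cochainsMap (MonoidHom.id G) (Rep.ofHom φ) +
        groupCohomology.cochainsMap (MonoidHom.id G) (Rep.ofHom ψ) := rfl
  have h2 := congr(HomologicalComplex.homologyMap $h n)
  rw [HomologicalComplex.homologyMap_add] at h2
  exact congr($h2 x)

end Functoriality

/-! ### Long exact sequences and naturality of connecting maps -/

section LongExact

variable {R G H V₁ V₂ V₃ W₁ W₂ W₃ : Type} [CommRing R] [Group G] [Group H]
  [AddCommGroup V₁] [Module R V₁] [AddCommGroup V₂] [Module R V₂] [AddCommGroup V₃] [Module R V₃]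
  [AddCommGroup W₁] [Module R W₁] [AddCommGroup W₂] [Module R W₂] [AddCommGroup W₃] [Module R W₃]

theorem rep_exact_of_function_exact (S : ShortComplex (Rep.{0} R G))
    (h : Function.Exact S.f.hom S.g.hom) : S.Exact := by
  rw [← ShortComplex.exact_map_iff_of_faithful _ (forget₂ (Rep.{0} R G) (ModuleCat.{0} R))]
  exact (ShortComplex.ShortExact.moduleCat_exact_iff_function_exact _).2 h

/-- A short exact sequence of unbundled representations. -/
structure ShortExactSeq (ρ₁ : Representation R G V₁) (ρ₂ : Representation R G V₂)
    (ρ₃ : Representation R G V₃) where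
  /-- the injection -/
  i : IntertwiningMap ρ₁ ρ₂
  /-- the surjection -/
  p : IntertwiningMap ρ₂ ρ₃
  inj : Function.Injective i
  surj : Function.Surjective p
  exact : Function.Exact i p

namespace ShortExactSeq

variable {ρ₁ : Representation R G V₁} {ρ₂ : Representation R G V₂} {ρ₃ : Representation R G V₃}

/-- The associated short complex. -/
noncomputable def toShortComplex (S : ShortExactSeq ρ₁ ρ₂ ρ₃) : ShortComplex (Rep R G) :=
  ShortComplex.mk (Rep.ofHom S.i) (Rep.ofHom S.p) (by
    ext v
    exact (S.exact _).2 ⟨v, rfl⟩)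

theorem shortExact (S : ShortExactSeq ρ₁ ρ₂ ρ₃) : S.toShortComplex.ShortExact where
  exact := by
    exact rep_exact_of_function_exact _ S.exact
  mono_f := (Rep.mono_iff_injective _).2 S.inj
  epi_g := (Rep.epi_iff_surjective _).2 S.surj

/-- The connecting homomorphism. -/
noncomputable def δ (S : ShortExactSeq ρ₁ ρ₂ ρ₃) (n : ℕ) : coh ρ₃ n →ₗ[R] coh ρ₁ (n + 1) :=
  (groupCohomology.δ S.shortExact n (n + 1) rfl).hom

theorem exact₁ (S : ShortExactSeq ρ₁ ρ₂ ρ₃) (n : ℕ) :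
    Function.Exact (S.δ n) (coeffMap S.i (n + 1)) :=
  (ShortComplex.ShortExact.moduleCat_exact_iff_function_exact _).1
    (groupCohomology.mapShortComplex₁_exact S.shortExact (i := n) rfl)

theorem exact₂ (S : ShortExactSeq ρ₁ ρ₂ ρ₃) (n : ℕ) : Function.Exact (coeffMap S.i n)
    (coeffMap S.p n) :=
  (ShortComplex.ShortExact.moduleCat_exact_iff_function_exact _).1
    (groupCohomology.mapShortComplex₂_exact S.shortExact n)

theorem exact₃ (S : ShortExactSeq ρ₁ ρ₂ ρ₃) (n : ℕ) : Function.Exact (coeffMap S.p n) (S.δ n) :=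
  (ShortComplex.ShortExact.moduleCat_exact_iff_function_exact _).1
    (groupCohomology.mapShortComplex₃_exact S.shortExact (i := n) rfl)

theorem δ_injective (S : ShortExactSeq ρ₁ ρ₂ ρ₃) (n : ℕ)
    (h : ∀ x : coh ρ₂ n, coeffMap S.p n x = 0) :
    Function.Injective (S.δ n) := by
  rw [injective_iff_map_eq_zero]
  intro x hx
  obtain ⟨y, rfl⟩ := (S.exact₃ n x).1 hx
  exact h y

theorem δ_surjective (S : ShortExactSeq ρ₁ ρ₂ ρ₃) (n : ℕ) (h : Subsingleton (coh ρ₂ (n + 1))) :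
    Function.Surjective (S.δ n) := fun x =>
  (S.exact₁ n x).1 (by
    have : coeffMap S.i (n + 1) x = coeffMap S.i (n + 1) 0 := Subsingleton.elim _ _
    rw [this, map_zero])

theorem δ_injective_of_subsingleton (S : ShortExactSeq ρ₁ ρ₂ ρ₃) (n : ℕ)
    (h : Subsingleton (coh ρ₂ n)) :
    Function.Injective (S.δ n) :=
  S.δ_injective n fun x => by rw [Subsingleton.elim x 0, map_zero]

theorem subsingleton₁ (S : ShortExactSeq ρ₁ ρ₂ ρ₃) (n : ℕ) (h₃ : Subsingleton (coh ρ₃ n))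
    (h₂ : Subsingleton (coh ρ₂ (n + 1))) :
    Subsingleton (coh ρ₁ (n + 1)) :=
  (S.δ_surjective n h₂).subsingleton

theorem subsingleton₃ (S : ShortExactSeq ρ₁ ρ₂ ρ₃) (n : ℕ) (h₂ : Subsingleton (coh ρ₂ n))
    (h₁ : Subsingleton (coh ρ₁ (n + 1))) :
    Subsingleton (coh ρ₃ n) :=
  (S.δ_injective_of_subsingleton n h₂).subsingleton

theorem δ_naturality {σ₁ : Representation R H W₁} {σ₂ : Representation R H W₂}
    {σ₃ : Representation R H W₃} (S : ShortExactSeq ρ₁ ρ₂ ρ₃) (T : ShortExactSeq σ₁ σ₂ σ₃)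
    (f : H →* G) (φ₁ : IntertwiningMap (ρ₁.comp f) σ₁) (φ₂ : IntertwiningMap (ρ₂.comp f) σ₂)
    (φ₃ : IntertwiningMap (ρ₃.comp f) σ₃) (hi : ∀ v, T.i (φ₁ v) = φ₂ (S.i v))
    (hp : ∀ v, T.p (φ₂ v) = φ₃ (S.p v)) (n : ℕ) (x : coh ρ₃ n) :
    cohMap f φ₁ (n + 1) (S.δ n x) = T.δ n (cohMap f φ₃ n x) := by
  let F : S.toShortComplex.map (groupCohomology.cochainsFunctor R G) ⟶
      T.toShortComplex.map (groupCohomology.cochainsFunctor R H) :=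
    { τ₁ := groupCohomology.cochainsMap (A := Rep.of ρ₁) (B := Rep.of σ₁) f (Rep.ofHom φ₁)
      τ₂ := groupCohomology.cochainsMap (A := Rep.of ρ₂) (B := Rep.of σ₂) f (Rep.ofHom φ₂)
      τ₃ := groupCohomology.cochainsMap (A := Rep.of ρ₃) (B := Rep.of σ₃) f (Rep.ofHom φ₃)
      comm₁₂ := by
        ext n x
        funext g
        exact hi _
      comm₂₃ := by
        ext n x
        funext g
        exact hp _ }
  have := HomologicalComplex.HomologySequence.δ_naturality F
    (groupCohomology.map_cochainsFunctor_shortExact S.shortExact)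
    (groupCohomology.map_cochainsFunctor_shortExact T.shortExact) n (n + 1) rfl
  exact congr($this x)

end ShortExactSeq

end LongExact

/-! ### Acyclicity by averaging -/

section Acyclic

variable {R G V : Type} [CommRing R] [Group G] [AddCommGroup V] [Module R V]

theorem contractNth_succ_cons {M : Type} (op : M → M → M) {n : ℕ} (x : M) (g : Fin (n + 1) → M)
    (i : Fin (n + 1)) :
    Fin.contractNth i.succ op (Fin.cons x g : Fin (n + 2) → M) =
      Fin.cons x (Fin.contractNth i op g) := by
  ext j
  refine Fin.cases ?_ (fun j => ?_) j
  · simp [Fin.contractNth]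
  · simp [Fin.contractNth]

theorem contractNth_zero_cons {M : Type} (op : M → M → M) {n : ℕ} (x : M) (g : Fin (n + 1) → M) :
    Fin.contractNth 0 op (Fin.cons x g : Fin (n + 2) → M) =
      Fin.cons (op x (g 0)) (fun i => g i.succ) := by
  ext j
  refine Fin.cases ?_ (fun j => ?_) j
  · simp [Fin.contractNth]
  · simp [Fin.contractNth]

theorem d_apply (ρ : Representation R G V) {n : ℕ} (F : (Fin n → G) → V) (g : Fin (n + 1) → G) :
    inhomogeneousCochains.d (Rep.of ρ) n F g = ρ (g 0) (F fun i => g i.succ) +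
      ∑ j : Fin (n + 1), (-1 : R) ^ ((j : ℕ) + 1) • F (Fin.contractNth j (· * ·) g) := rfl

/-- For every `x`, the cocycle identity at `(x⁻¹, g)`, moved by `ρ x`, expresses `F g` as a
coboundary that depends on `x`. Applying `κ` over `x` removes the dependence. -/
theorem eq_d_of_average (ρ : Representation R G V) (κ : (G → V) →ₗ[R] V)
    (hconst : ∀ v, κ (fun _ => v) = v)
    (hequiv : ∀ g φ, κ (fun x => ρ g (φ (g⁻¹ * x))) = ρ g (κ φ)) (n : ℕ)
    (F : (Fin (n + 1) → G) → V)
    (hF : inhomogeneousCochains.d (Rep.of ρ) (n + 1) F = 0) :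
    inhomogeneousCochains.d (Rep.of ρ) n
      (fun y => κ fun x => ρ x (F (Fin.cons x⁻¹ y))) = F := by
  funext g
  have key : ∀ x : G, F g = ρ x (F (Fin.cons (x⁻¹ * g 0) fun i => g i.succ)) +
      ∑ i : Fin (n + 1), (-1 : R) ^ ((i : ℕ) + 1) •
        ρ x (F (Fin.cons x⁻¹ (Fin.contractNth i (· * ·) g))) := by
    intro x
    have h : _ = (0 : V) := (d_apply ρ F _).symm.trans (congrFun hF (Fin.cons x⁻¹ g))
    rw [Fin.sum_univ_succ] at h
    simp only [Fin.cons_zero, Fin.cons_succ, contractNth_zero_cons, contractNth_succ_cons] at h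
    have h2 := congrArg (ρ x) h
    simp only [map_add, map_sum, map_smul, map_zero, Fin.val_zero,
      Fin.val_succ, zero_add, pow_one, neg_smul, one_smul] at h2
    rw [← Module.End.mul_apply, ← map_mul, mul_inv_cancel, map_one, Module.End.one_apply] at h2
    simp only [pow_succ _ (_ + 1), mul_neg, mul_one, neg_smul, Finset.sum_neg_distrib,
      map_neg] at h2
    rw [← sub_eq_zero, ← h2]
    abel
  refine (d_apply ρ _ g).trans ?_
  -- Moving `ρ (g 0)` inside `κ` shifts `x` to `(g 0)⁻¹ * x`, which matches the first term of `key`.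
  rw [← hequiv]
  simp only [← map_smul κ, ← map_sum κ, ← map_add κ]
  refine Eq.trans ?_ (hconst (F g))
  congr 1
  funext x
  rw [key x]
  simp [← Module.End.mul_apply, ← map_mul, mul_inv_rev]

/-- A representation on which functions `G → V` can be averaged equivariantly is acyclic. -/
theorem subsingleton_coh_of_average (ρ : Representation R G V) (κ : (G → V) →ₗ[R] V)
    (hconst : ∀ v, κ (fun _ => v) = v)
    (hequiv : ∀ g φ, κ (fun x => ρ g (φ (g⁻¹ * x))) = ρ g (κ φ)) (n : ℕ) :
    Subsingleton (groupCohomology (Rep.of ρ) (n + 1)) := by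
  refine subsingleton_of_forall_eq 0 fun x => ?_
  induction x using groupCohomology_induction_on with
  | h z =>
    have hz : (groupCohomology.inhomogeneousCochains (Rep.of ρ)).d (n + 1) (n + 2)
        (groupCohomology.iCocycles (Rep.of ρ) (n + 1) z) = 0 :=
      congr($((groupCohomology.inhomogeneousCochains (Rep.of ρ)).iCycles_d (n + 1) (n + 2)) z)
    rw [groupCohomology.inhomogeneousCochains.d_def] at hz
    have h := eq_d_of_average ρ κ hconst hequiv n _ hz
    have h2 : groupCohomology.toCocycles (Rep.of ρ) n (n + 1)
        (fun y => κ fun x => ρ x (groupCohomology.iCocycles (Rep.of ρ) (n + 1) z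
          (Fin.cons x⁻¹ y))) = z := by
      apply (ModuleCat.mono_iff_injective (groupCohomology.iCocycles (Rep.of ρ) (n + 1))).1
        inferInstance
      rw [← groupCohomology.inhomogeneousCochains.d_def] at h
      refine Eq.trans ?_ h
      exact congr($((groupCohomology.inhomogeneousCochains (Rep.of ρ)).toCycles_i n (n + 1)) _)
    rw [← h2]
    exact congr($((groupCohomology.inhomogeneousCochains
      (Rep.of ρ)).toCycles_comp_homologyπ n (n + 1)) _)

end Acyclic

/-! ### Functions on a `G`-set, and functions up to constants -/

section FunctionRep

variable {R G H S V : Type} [CommRing R] [Group G] [Group H] [AddCommGroup V] [Module R V]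

/-- The representation on functions `S → V`, for a `G`-set `S` and a `G`-module `V`. -/
def funRep (a : G →* Equiv.Perm S) (ρ : Representation R G V) : Representation R G (S → V) where
  toFun g := (ρ g).compLeft S ∘ₗ LinearMap.funLeft R V (a g⁻¹)
  map_one' := by ext; simp
  map_mul' g h := by ext; simp [LinearMap.funLeft]

@[simp]
theorem funRep_apply (a : G →* Equiv.Perm S) (ρ : Representation R G V) (g : G) (F : S → V)
    (s : S) : funRep a ρ g F s = ρ g (F (a g⁻¹ s)) := rfl

variable (R S V) in
/-- The submodule of functions of two variables that are differences of a function of one variable.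
-/
def diffSubmodule : Submodule R (S → S → V) where
  carrier := {x | ∀ s t u, x s t + x t u = x s u}
  add_mem' {x y} hx hy s t u := by
    simp only [Pi.add_apply, ← hx s t u, ← hy s t u]
    abel
  zero_mem' := by simp
  smul_mem' c x hx s t u := by simp [← hx s t u, smul_add]

variable (R S V) in
/-- Functions up to constants, in the form of differences of functions. -/
def Diff : Type := diffSubmodule R S V

instance : AddCommGroup (Diff R S V) := inferInstanceAs (AddCommGroup (diffSubmodule R S V))

instance : Module R (Diff R S V) := inferInstanceAs (Module R (diffSubmodule R S V))

@[ext]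
theorem Diff.ext {x y : Diff R S V} (h : ∀ s t, x.1 s t = y.1 s t) : x = y :=
  Subtype.ext (funext fun s => funext fun t => h s t)

/-- The differences of a function. -/
def Diff.of (F : S → V) : Diff R S V := ⟨fun s t => F t - F s, fun _ _ _ => sub_add_sub_cancel' _ _
    _⟩

@[simp]
theorem Diff.add_apply (x y : Diff R S V) (s t : S) : (x + y).1 s t = x.1 s t + y.1 s t := rfl

@[simp]
theorem Diff.neg_apply (x : Diff R S V) (s t : S) : (-x).1 s t = -x.1 s t := rfl

@[simp]
theorem Diff.smul_apply (c : R) (x : Diff R S V) (s t : S) : (c • x).1 s t = c • x.1 s t := rfl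

theorem diff_add (x : Diff R S V) (s t u : S) : x.1 s t + x.1 t u = x.1 s u := x.2 s t u

@[simp]
theorem diff_self (x : Diff R S V) (s : S) : x.1 s s = 0 := by
  simpa using diff_add x s s s

theorem diff_swap (x : Diff R S V) (s t : S) : x.1 s t = -x.1 t s := by
  rw [eq_neg_iff_add_eq_zero, diff_add, diff_self]

/-- The representation on differences of functions, that is, on functions up to constants. -/
def diffRep (a : G →* Equiv.Perm S) (ρ : Representation R G V) :
    Representation R G (Diff R S V) where
  toFun g := (funRep a (funRep a ρ) g).restrict fun x hx s t u => by
    simp only [funRep_apply, ← hx (a g⁻¹ s) (a g⁻¹ t) (a g⁻¹ u), map_add]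
  map_one' := LinearMap.ext fun x =>
    Subtype.ext (LinearMap.congr_fun (map_one (funRep a (funRep a ρ))) x.1)
  map_mul' g h := LinearMap.ext fun x =>
    Subtype.ext (LinearMap.congr_fun (map_mul (funRep a (funRep a ρ)) g h) x.1)

theorem diffRep_comp (a : G →* Equiv.Perm S) (ρ : Representation R G V) (j : H →* G) :
    MonoidHom.comp (diffRep a ρ) j = diffRep (a.comp j) (MonoidHom.comp ρ j) := by
  refine MonoidHom.ext fun h => LinearMap.ext fun x => Diff.ext fun s t => ?_
  change ρ (j h) (x.1 (a (j h)⁻¹ s) (a (j h)⁻¹ t)) = ρ (j h) (x.1 (a (j h⁻¹) s) (a (j h⁻¹) t))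
  rw [map_inv j]

/-- Functions up to constants, as the cokernel of the constant functions. -/
def diffSeq [Nonempty S] (a : G →* Equiv.Perm S) (ρ : Representation R G V) :
    ShortExactSeq ρ (funRep a ρ) (diffRep a ρ) where
  i := { toLinearMap := LinearMap.pi fun _ => LinearMap.id
         isIntertwining' := fun g => by ext; rfl }
  p := { toLinearMap :=
          { toFun := Diff.of
            map_add' := fun F F' => Diff.ext fun s t => add_sub_add_comm _ _ _ _
            map_smul' := fun c F => Diff.ext fun s t => (smul_sub c (F t) (F s)).symm }
         isIntertwining' := fun g => by
          ext F s t
          exact (map_sub (ρ g) _ _).symm }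
  inj x y h := congrFun h (Classical.arbitrary S)
  surj x := ⟨fun s => x.1 (Classical.arbitrary S) s, by
    ext s t
    change x.1 _ t - x.1 _ s = x.1 s t
    rw [← diff_add x _ s t]
    abel⟩
  exact F := by
    constructor
    · intro h
      refine ⟨F (Classical.arbitrary S), ?_⟩
      funext s
      have := congrFun (congrFun (congrArg Subtype.val h) s) (Classical.arbitrary S)
      exact sub_eq_zero.1 this
    · rintro ⟨v, rfl⟩
      ext s t
      exact sub_self v

/-- Functions on a `G`-set with an equivariant map to `G` form an acyclic representation. -/
theorem subsingleton_coh_funRep (a : G →* Equiv.Perm S) (ρ : Representation R G V) (c : S → G)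
    (hc : ∀ g s, c (a g s) = g * c s) (n : ℕ) : Subsingleton (coh (funRep a ρ) (n + 1)) :=
  subsingleton_coh_of_average (funRep a ρ)
    { toFun := fun φ s => φ (c s) s
      map_add' := fun _ _ => rfl
      map_smul' := fun _ _ => rfl }
    (fun _ => rfl)
    (fun g φ => by
      funext s
      change ρ g (φ (g⁻¹ * c s) (a g⁻¹ s)) = ρ g (φ (c (a g⁻¹ s)) (a g⁻¹ s))
      rw [hc]) n

/-- The action of a group on itself by left multiplication. -/
def leftMul (G : Type) [Group G] : G →* Equiv.Perm G := MulAction.toPermHom G G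

theorem subsingleton_coh_funRep_leftMul (ρ : Representation R G V) (n : ℕ) :
    Subsingleton (coh (funRep (leftMul G) ρ) (n + 1)) :=
  subsingleton_coh_funRep _ _ id (fun _ _ => rfl) n

/-- Each point is reached from a chosen representative of its orbit by a group element, unique by
freeness and hence equivariant in the point. -/
theorem exists_equivariant_of_free (a : G →* Equiv.Perm S)
    (ha : ∀ g s, a g s = s → g = 1) : ∃ c : S → G, ∀ g s, c (a g s) = g * c s := by
  let _ : MulAction G S := MulAction.compHom S a
  let o : S → Quotient (MulAction.orbitRel G S) := Quotient.mk _
  have hr : ∀ s : S, ∃ g : G, a g (o s).out = s := by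
    intro s
    have h : (MulAction.orbitRel G S) s (o s).out :=
      Setoid.symm' _ (Quotient.exact (Quotient.out_eq (o s)))
    obtain ⟨g, hg⟩ := MulAction.orbitRel_apply.1 h
    exact ⟨g, hg⟩
  choose c hc using hr
  refine ⟨c, fun g s => ?_⟩
  have hq : o (a g s) = o s := Quotient.sound (MulAction.orbitRel_apply.2 ⟨g, rfl⟩)
  have h1 := hc (a g s)
  rw [hq] at h1
  refine (inv_mul_eq_one.1 (ha ((g * c s)⁻¹ * c (a g s)) (o s).out ?_)).symm
  rw [map_mul, Equiv.Perm.mul_apply, h1, map_inv, Equiv.Perm.inv_eq_iff_eq, map_mul,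
    Equiv.Perm.mul_apply, hc s]

/-- Functions on a free `G`-set form an acyclic representation. -/
theorem subsingleton_coh_funRep_of_free (a : G →* Equiv.Perm S) (ρ : Representation R G V)
    (ha : ∀ g s, a g s = s → g = 1) (n : ℕ) : Subsingleton (coh (funRep a ρ) (n + 1)) := by
  obtain ⟨c, hc⟩ := exists_equivariant_of_free a ha
  exact subsingleton_coh_funRep a ρ c hc n

end FunctionRep

/-! ### Central elements act trivially on cohomology -/

section Central

variable {R G V : Type} [CommRing R] [Group G] [AddCommGroup V] [Module R V]

/-- A central element acts on a representation by an equivariant map. -/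
def centralMap (ρ : Representation R G V) (c : G) (hc : ∀ g, g * c = c * g) :
    IntertwiningMap ρ ρ where
  toLinearMap := ρ c
  isIntertwining' g := by
    rw [← Module.End.mul_eq_comp, ← Module.End.mul_eq_comp, ← map_mul, ← map_mul, hc]

/-- A central element acts trivially on cohomology. -/
theorem coeffMap_centralMap (c : G) (hc : ∀ g, g * c = c * g) (n : ℕ) :
    ∀ {V : Type} [AddCommGroup V] [Module R V] (ρ : Representation R G V) (x : coh ρ n),
      coeffMap (centralMap ρ c hc) n x = x := by
  induction n with
  | zero =>
    intro V _ _ ρ x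
    have h := groupCohomology.map_id_comp_H0Iso_hom (Rep.ofHom (centralMap ρ c hc))
    refine (ModuleCat.mono_iff_injective (groupCohomology.H0Iso (Rep.of ρ)).hom).1 inferInstance ?_
    refine Eq.trans congr($h x) (Subtype.ext ?_)
    exact ((groupCohomology.H0Iso (Rep.of ρ)).hom x).2 c
  | succ n ih =>
    intro V _ _ ρ x
    -- Dimension shifting: every class comes from one degree lower by a connecting map, which
    -- commutes with the action of `c`.
    obtain ⟨y, rfl⟩ := (diffSeq (leftMul G) ρ).δ_surjective n
      (subsingleton_coh_funRep_leftMul ρ n) x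
    have h := ShortExactSeq.δ_naturality (diffSeq (leftMul G) ρ) (diffSeq (leftMul G) ρ)
      (MonoidHom.id G) (centralMap ρ c hc) (centralMap (funRep (leftMul G) ρ) c hc)
      (centralMap (diffRep (leftMul G) ρ) c hc) (fun _ => rfl)
      (fun v => (IntertwiningMap.isIntertwining _ _ (diffSeq (leftMul G) ρ).p c v)) n y
    exact h.trans (congrArg _ (ih (diffRep (leftMul G) ρ) y))

end Central

/-! ### Functions on `ℤ` and cohomological dimension -/

section Shift

variable {R G V : Type} [CommRing R] [Group G] [AddCommGroup V] [Module R V]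

/-- The action on `ℤ` by translations along a homomorphism to `ℤ`. -/
def shiftPerm (e : G →* Multiplicative ℤ) : G →* Equiv.Perm ℤ where
  toFun g := Equiv.addLeft (e g).toAdd
  map_one' := by ext; simp
  map_mul' g h := by ext; simp

@[simp]
theorem shiftPerm_apply (e : G →* Multiplicative ℤ) (g : G) (k : ℤ) :
    shiftPerm e g k = (e g).toAdd + k := rfl

/-- Every function on `ℤ` is a difference function. -/
theorem exists_forward_difference (C : ℤ → V) : ∃ F : ℤ → V, ∀ k, F (k + 1) - F k = C k := by
  let F : ℤ → V
    | Int.ofNat n => ∑ i ∈ Finset.range n, C i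
    | Int.negSucc n => -∑ i ∈ Finset.range (n + 1), C (-(i : ℤ) - 1)
  refine ⟨F, fun k => ?_⟩
  match k with
  | Int.ofNat n =>
    change ∑ i ∈ Finset.range (n + 1), C i - ∑ i ∈ Finset.range n, C i = C n
    rw [Finset.sum_range_succ]
    abel
  | Int.negSucc 0 =>
    change ∑ i ∈ Finset.range 0, C i - -∑ i ∈ Finset.range (0 + 1), C (-(i : ℤ) - 1) = _
    simp
  | Int.negSucc (n + 1) =>
    change -∑ i ∈ Finset.range (n + 1), C (-(i : ℤ) - 1) -
      -∑ i ∈ Finset.range (n + 1 + 1), C (-(i : ℤ) - 1) = _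
    rw [Finset.sum_range_succ _ (n + 1), Int.negSucc_eq]
    push_cast
    rw [show -((n : ℤ) + 1) - 1 = -((n : ℤ) + 1 + 1) by ring]
    abel

theorem eq_const_of_forward_difference_eq_zero (F : ℤ → V) (h : ∀ k, F (k + 1) - F k = 0) (k : ℤ) :
    F k = F 0 := by
  induction k using Int.induction_on with
  | zero => rfl
  | succ i ih => rw [sub_eq_zero.1 (h i), ih]
  | pred i ih =>
    have := sub_eq_zero.1 (h (-i - 1))
    rw [sub_add_cancel] at this
    rw [← this, ih]

/-- The constant functions on `ℤ` as the kernel of the difference operator. -/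
def shiftSeq (e : G →* Multiplicative ℤ) (ρ : Representation R G V) :
    ShortExactSeq ρ (funRep (shiftPerm e) ρ) (funRep (shiftPerm e) ρ) where
  i := { toLinearMap := LinearMap.pi fun _ => LinearMap.id
         isIntertwining' := fun g => by ext; rfl }
  p := { toLinearMap :=
          { toFun := fun F k => F (k + 1) - F k
            map_add' := fun F F' => by ext k; simp; abel
            map_smul' := fun c F => by ext k; simp [smul_sub] }
         isIntertwining' := fun g => LinearMap.ext fun F => by
          funext k
          change ρ g (F (_ + (k + 1))) - ρ g (F (_ + k)) = ρ g (F (_ + k + 1) - F (_ + k))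
          rw [map_sub, add_assoc] }
  inj x y h := congrFun h 0
  surj x := by
    obtain ⟨F, hF⟩ := exists_forward_difference x
    exact ⟨F, funext hF⟩
  exact F := by
    constructor
    · intro h
      refine ⟨F 0, funext fun k => ?_⟩
      exact (eq_const_of_forward_difference_eq_zero F (fun j => congrFun h j) k).symm
    · rintro ⟨v, rfl⟩
      exact funext fun k => sub_self v

/-- The infinite cyclic group has cohomological dimension one. -/
theorem subsingleton_coh_of_injective (e : G →* Multiplicative ℤ) (he : Function.Injective e)
    (ρ : Representation R G V) (n : ℕ) : Subsingleton (coh ρ (n + 2)) := by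
  have h : ∀ n, Subsingleton (coh (funRep (shiftPerm e) ρ) (n + 1)) := fun n =>
    subsingleton_coh_funRep_of_free _ _ (fun g k hk => he (by
      rw [map_one]
      simpa using hk)) n
  exact (shiftSeq e ρ).subsingleton₁ (n + 1) (h n) (h (n + 1))

/-- A group that embeds in `ℤ²` has cohomological dimension at most two. -/
theorem subsingleton_coh_of_section (e₁ e₂ : G →* Multiplicative ℤ) (c : ℤ → ℤ → G)
    (hc : ∀ g i j, c ((e₂ g).toAdd + i) ((e₁ g).toAdd + j) = g * c i j)
    (ρ : Representation R G V) (n : ℕ) : Subsingleton (coh ρ (n + 3)) := by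
  -- Functions of two integers can be averaged along the equivariant `c`. Each of the two difference
  -- sequences then costs one degree.
  have h : ∀ n, Subsingleton (coh (funRep (shiftPerm e₂) (funRep (shiftPerm e₁) ρ)) (n + 1)) :=
    fun n => subsingleton_coh_of_average _
      { toFun := fun (φ : G → ℤ → ℤ → V) i j => φ (c i j) i j
        map_add' := fun _ _ => rfl
        map_smul' := fun _ _ => rfl }
      (fun _ => rfl)
      (fun g φ => by
        funext i j
        change ρ g (φ (g⁻¹ * c i j) _ _) = ρ g (φ (c ((e₂ g⁻¹).toAdd + i) ((e₁ g⁻¹).toAdd + j)) _ _)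
        rw [hc]) n
  have h1 : ∀ n, Subsingleton (coh (funRep (shiftPerm e₁) ρ) (n + 2)) := fun n =>
    (shiftSeq e₂ (funRep (shiftPerm e₁) ρ)).subsingleton₁ (n + 1) (h n) (h (n + 1))
  exact (shiftSeq e₁ ρ).subsingleton₁ (n + 2) (h1 n) (h1 (n + 1))

end Shift

/-! ### Shapiro's lemma for transitive actions -/

section Shapiro

variable {R G E S : Type} [CommRing R] [Group G] [Group E]

/-- Functions on a transitive `G`-set with stabiliser `T` are coinduced from `T`. -/
noncomputable def funRepEquivCoind (a : G →* Equiv.Perm S) (s₀ : S)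
    (htrans : ∀ s, ∃ g, a g s₀ = s) (T : Subgroup G) (hT : ∀ g, a g s₀ = s₀ ↔ g ∈ T) :
    (funRep a (trivial R G R)).Equiv (coind T.subtype (trivial R T R)) where
  toFun F := ⟨fun g => F (a g⁻¹ s₀), fun t g => by
    have : a (t : G)⁻¹ s₀ = s₀ := (hT _).2 (T.inv_mem t.2)
    simp [-map_inv, this]⟩
  map_add' _ _ := rfl
  map_smul' _ _ := rfl
  isIntertwining' g := LinearMap.ext fun F => Subtype.ext <| funext fun h => by
    change F (a g⁻¹ (a h⁻¹ s₀)) = F (a (h * g)⁻¹ s₀)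
    rw [mul_inv_rev, map_mul, Equiv.Perm.mul_apply]
  invFun f s := f.1 (htrans s).choose⁻¹
  left_inv F := funext fun s => by
    change F (a (htrans s).choose⁻¹⁻¹ s₀) = F s
    rw [inv_inv, (htrans s).choose_spec]
  right_inv f := Subtype.ext <| funext fun g => by
    have h := (htrans (a g⁻¹ s₀)).choose_spec
    set g' := (htrans (a g⁻¹ s₀)).choose
    have h2 : g'⁻¹ * g⁻¹ ∈ T := (hT _).1 (by
      rw [map_mul, Equiv.Perm.mul_apply, ← h, ← Equiv.Perm.mul_apply, ← map_mul,
        inv_mul_cancel, map_one, Equiv.Perm.one_apply])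
    have h3 := f.2 ⟨_, h2⟩ g
    change f.1 g'⁻¹ = f.1 g
    simpa using h3

/-- Transitivity makes functions on `S` coinduced from the stabiliser of `s₀`, which `σ` identifies
with `E`. -/
theorem nonempty_coh_funRep_equiv (a : G →* Equiv.Perm S) (s₀ : S)
    (htrans : ∀ s, ∃ g, a g s₀ = s) (σ : E →* G) (hσ : Function.Injective σ)
    (hT : ∀ g, a g s₀ = s₀ ↔ g ∈ σ.range) (n : ℕ) :
    Nonempty (coh (funRep a (trivial R G R)) n ≃ₗ[R] coh (trivial R E R) n) := by
  have i1 := (groupCohomology.functor R G n).mapIso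
    (Rep.mkIso (funRepEquivCoind (R := R) a s₀ htrans σ.range hT))
  have i2 := groupCohomology.coindIso (Rep.trivial R σ.range R) n
  have i3 := groupCohomology.mapIso (A := Rep.trivial R σ.range R) (B := Rep.trivial R E R)
    (MonoidHom.ofInjective hσ) (LinearEquiv.refl R R) (fun _ => rfl) n
  exact ⟨(i1 ≪≫ i2 ≪≫ i3.symm).toLinearEquiv⟩

end Shapiro

/-! ### Finite cyclic groups -/

section Cyclic

variable {C : Type} [CommGroup C] [Fintype C]

theorem epi_groupCohomologyπEven {k : Type} [CommRing k] (A : Rep k C) (g : C)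
    (hg : ∀ x, x ∈ Subgroup.zpowers g) (n : ℕ) [NeZero n] (hn : Even n) :
    Epi (Rep.FiniteCyclicGroup.groupCohomologyπEven A g hg n hn) :=
  epi_comp' (@IsIso.epi_of_iso _ _ _ _ _ (ShortComplex.moduleCatCyclesIso _).isIso_inv)
    (epi_comp' inferInstance inferInstance)

theorem trivial_norm_apply (x : ℤ) :
    (Rep.trivial ℤ C ℤ).norm.hom.toLinearMap x = Fintype.card C * x := by
  simp [Rep.norm, Representation.norm]

/-- Odd cohomology is the kernel of the norm modulo the image of `g - 1`, and the norm on `ℤ` is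
multiplication by the order, which is injective. -/
theorem subsingleton_coh_cyclic_odd (g : C) (hg : ∀ x, x ∈ Subgroup.zpowers g) (n : ℕ)
    (hn : Odd n) : Subsingleton (coh (trivial ℤ C ℤ) n) := by
  have h : (Rep.FiniteCyclicGroup.subCompNormHom (Rep.trivial ℤ C ℤ) g).Exact := by
    rw [ShortComplex.ShortExact.moduleCat_exact_iff_function_exact]
    intro x
    constructor
    · intro hx
      have h : (Fintype.card C : ℤ) * x = 0 := (trivial_norm_apply x).symm.trans hx
      have hx0 : x = 0 := by simpa using h
      exact ⟨0, by rw [hx0, map_zero]⟩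
    · rintro ⟨y, rfl⟩
      have : (ConcreteCategory.hom
          (Rep.FiniteCyclicGroup.subCompNormHom (Rep.trivial ℤ C ℤ) g).f) y = 0 := sub_self y
      rw [this, map_zero]
  rw [ShortComplex.exact_iff_isZero_homology] at h
  exact ModuleCat.subsingleton_of_isZero
    (h.of_iso (Rep.FiniteCyclicGroup.groupCohomologyIsoOdd (Rep.trivial ℤ C ℤ) g hg n hn))

/-- Even positive cohomology is invariants modulo norms, here `ℤ` modulo multiples of the order. -/
theorem nonempty_coh_cyclic_two (g : C) (hg : ∀ x, x ∈ Subgroup.zpowers g) :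
    Nonempty (ZMod (Fintype.card C) ≃+ coh (trivial ℤ C ℤ) 2) := by
  let A := Rep.trivial ℤ C ℤ
  let π := Rep.FiniteCyclicGroup.groupCohomologyπEven A g hg 2 even_two
  have hπ : Function.Surjective π := (ModuleCat.epi_iff_surjective π).1
    (epi_groupCohomologyπEven _ g hg 2 even_two)
  let ι : ℤ →+ LinearMap.ker (Rep.applyAsHom A g - 𝟙 A).hom.toLinearMap :=
    { toFun := fun x => ⟨x, sub_self x⟩
      map_zero' := rfl
      map_add' := fun _ _ => rfl }
  let q : ℤ →+ coh (trivial ℤ C ℤ) 2 := π.hom.toAddMonoidHom.comp ι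
  have hq : Function.Surjective q := hπ.comp fun x => ⟨x.1, rfl⟩
  have hker : q.ker = AddSubgroup.zmultiples (Fintype.card C : ℤ) := by
    ext x
    rw [AddMonoidHom.mem_ker, Int.mem_zmultiples_iff]
    refine (Rep.FiniteCyclicGroup.groupCohomologyπEven_eq_zero_iff A g hg 2 even_two (ι x)).trans ?_
    constructor
    · rintro ⟨y, hy⟩
      exact ⟨y, hy.symm.trans (trivial_norm_apply y)⟩
    · rintro ⟨y, hy⟩
      exact ⟨y, (trivial_norm_apply y).trans hy.symm⟩
  exact ⟨(Int.quotientZMultiplesNatEquivZMod _).symm.trans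
    ((QuotientAddGroup.quotientAddEquivOfEq hker.symm).trans
      (QuotientAddGroup.quotientKerEquivOfSurjective q hq))⟩

end Cyclic

/-! ### Abelian extensions of `ℤ` by a finite cyclic group -/

section InfiniteByCyclic

variable {E : Type} [CommGroup E] (e : E →* Multiplicative ℤ)

/-- Functions on `ℤ`, with `E` acting by translations through `e`, compute the cohomology of the
kernel of `e`. -/
theorem nonempty_coh_shift_equiv {R : Type} [CommRing R] (he : Function.Surjective e) (n : ℕ) :
    Nonempty (coh (funRep (shiftPerm e) (trivial R E R)) n ≃ₗ[R]
      coh (trivial R e.ker R) n) := by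
  refine nonempty_coh_funRep_equiv (shiftPerm e) 0 (fun s => ?_) e.ker.subtype
    Subtype.val_injective (fun g => ?_) n
  · obtain ⟨g, hg⟩ := he (Multiplicative.ofAdd s)
    exact ⟨g, by simp [hg]⟩
  · simp only [shiftPerm_apply, add_zero, Subgroup.range_subtype, MonoidHom.mem_ker]
    exact Iff.rfl

/-- The difference operator is `s - 1` for a central `s`, and `s` acts as the identity on
cohomology. The long exact sequence therefore breaks into pieces `0 → Hⁿ(ker e) → Hⁿ⁺¹(E) → Hⁿ⁺¹(ker
e) → 0`. -/
theorem coeffMap_shiftSeq_p_eq_zero {R : Type} [CommRing R] (he : Function.Surjective e) (n : ℕ)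
    (x : coh (funRep (shiftPerm e) (trivial R E R)) n) :
    coeffMap (shiftSeq e (trivial R E R)).p n x = 0 := by
  -- Functions transform through the inverse, so the value `-1` produces the shift `F (k + 1)`.
  obtain ⟨s, hs⟩ := he (Multiplicative.ofAdd (-1))
  have hc : ∀ g, g * s = s * g := fun g => mul_comm g s
  have h := coeffMap_add ((shiftSeq e (trivial R E R)).p)
    (IntertwiningMap.id (funRep (shiftPerm e) (trivial R E R))) n x
  have h2 : (shiftSeq e (trivial R E R)).p + IntertwiningMap.id _ =
      centralMap (funRep (shiftPerm e) (trivial R E R)) s hc := by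
    ext F : 2
    funext k
    change F (k + 1) - F k + F k = F ((e s⁻¹).toAdd + k)
    rw [map_inv, hs, sub_add_cancel, ← ofAdd_neg, toAdd_ofAdd, neg_neg, add_comm]
  rw [h2, coeffMap_centralMap, coeffMap, cohMap_id, eq_comm, add_eq_right] at h
  exact h

variable [Finite e.ker]

/-- Since `H¹(ker e) = 0`, the piece with `n = 1` identifies `H²(E)` with `H²(ker e)`. -/
theorem nonempty_coh_two_equiv (he : Function.Surjective e) (hcyc : IsCyclic e.ker) :
    Nonempty (coh (trivial ℤ E ℤ) 2 ≃+ ZMod (Nat.card e.ker)) := by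
  have := Fintype.ofFinite e.ker
  rw [Nat.card_eq_fintype_card]
  obtain ⟨g, hg⟩ := hcyc
  obtain ⟨s⟩ := nonempty_coh_cyclic_two g hg
  obtain ⟨t⟩ := nonempty_coh_shift_equiv (R := ℤ) e he 2
  obtain ⟨t1⟩ := nonempty_coh_shift_equiv (R := ℤ) e he 1
  have h1 := subsingleton_coh_cyclic_odd g hg 1 (by decide)
  let S := shiftSeq e (trivial ℤ E ℤ)
  have hi : Function.Bijective (coeffMap S.i 2) := by
    refine ⟨(injective_iff_map_eq_zero _).2 fun x hx => ?_, fun x =>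
      (S.exact₂ 2 x).1 (coeffMap_shiftSeq_p_eq_zero e he 2 x)⟩
    obtain ⟨y, rfl⟩ := (S.exact₁ 1 x).1 hx
    rw [t1.injective.subsingleton.elim y 0, map_zero]
  exact ⟨((LinearEquiv.ofBijective (coeffMap S.i 2) hi).trans t).toAddEquiv.trans s.symm⟩

/-- Since `H³(ker e) = 0`, the piece with `n = 2` identifies `H³(E)` with `H²(ker e)` through the
connecting map. -/
theorem nonempty_coh_three_equiv (he : Function.Surjective e) (hcyc : IsCyclic e.ker) :
    Nonempty (coh (trivial ℤ E ℤ) 3 ≃+ ZMod (Nat.card e.ker)) := by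
  have := Fintype.ofFinite e.ker
  rw [Nat.card_eq_fintype_card]
  obtain ⟨g, hg⟩ := hcyc
  obtain ⟨s⟩ := nonempty_coh_cyclic_two g hg
  obtain ⟨t⟩ := nonempty_coh_shift_equiv (R := ℤ) e he 2
  obtain ⟨t3⟩ := nonempty_coh_shift_equiv (R := ℤ) e he 3
  have h3 := subsingleton_coh_cyclic_odd g hg 3 (by decide)
  let S := shiftSeq e (trivial ℤ E ℤ)
  have hδ : Function.Bijective (S.δ 2) :=
    ⟨S.δ_injective 2 (coeffMap_shiftSeq_p_eq_zero e he 2), S.δ_surjective 2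
      t3.injective.subsingleton⟩
  exact ⟨((s.trans t.symm.toAddEquiv).trans
    (LinearEquiv.ofBijective (S.δ 2) hδ).toAddEquiv).symm⟩

end InfiniteByCyclic

/-! ### The curl of a cocycle of the plane lattice -/

section Curl

variable {R : Type} [CommRing R]

/-- The determinant of two vectors of the plane lattice. -/
def planeDet (t u : Fin 2 → ℤ) : ℤ := t 0 * u 1 - t 1 * u 0

theorem eq_smul_add_smul (t : Fin 2 → ℤ) : t = t 0 • ![1, 0] + t 1 • ![0, 1] := by
  ext i
  fin_cases i <;> simp

/-- Functions on the plane lattice up to constants. -/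
abbrev PlaneDiff (R : Type) [CommRing R] : Type := Diff R (Fin 2 → ℤ) R

/-- The obstruction for a family of functions to be the differences, by translations, of a single
function. -/
def curl (c : (Fin 2 → ℤ) → PlaneDiff R) (t u v : Fin 2 → ℤ) : R :=
  (c u).1 v (v - t) - (c t).1 v (v - u)

/-- One-cocycles of the plane lattice with values in functions up to constants. -/
def IsPlaneCocycle (c : (Fin 2 → ℤ) → PlaneDiff R) : Prop :=
  ∀ t u v w, (c (t + u)).1 v w = (c t).1 v w + (c u).1 (v - t) (w - t)

variable {c : (Fin 2 → ℤ) → PlaneDiff R}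

/-- The two expansions of `c (t + u) = c (u + t)` by the cocycle condition agree. Up to sign, the
constant is the value on the torus spanned by `t` and `u` of the class of `c` in `H²(ℤ², R)`. -/
theorem curl_const (hc : IsPlaneCocycle c) (t u v w : Fin 2 → ℤ) : curl c t u v = curl c t u w := by
  have h1 := hc t u v w
  have h2 := hc u t v w
  rw [add_comm u t, h1] at h2
  have a1 := diff_add (c u) v (v - t) (w - t)
  have a2 := diff_add (c u) v w (w - t)
  have b1 := diff_add (c t) v (v - u) (w - u)
  have b2 := diff_add (c t) v w (w - u)
  unfold curl
  linear_combination a1 - a2 - b1 + b2 - h2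

theorem curl_add_left (hc : IsPlaneCocycle c) (t t' u v : Fin 2 → ℤ) :
    curl c (t + t') u v = curl c t u v + curl c t' u v := by
  rw [curl_const hc t' u v (v - t)]
  have h1 := hc t t' v (v - u)
  have h2 := diff_add (c u) v (v - t) (v - t - t')
  unfold curl
  rw [h1, ← sub_sub v t t', sub_right_comm v t u]
  linear_combination -h2

theorem curl_swap (t u v : Fin 2 → ℤ) : curl c t u v = -curl c u t v := by
  unfold curl
  ring

theorem curl_self (t v : Fin 2 → ℤ) : curl c t t v = 0 := sub_self _

/-- An additive alternating form on `ℤ²` is determined by its value on the standard basis. -/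
theorem curl_eq_det_smul (hc : IsPlaneCocycle c) (t u v : Fin 2 → ℤ) :
    curl c t u v = planeDet t u • curl c ![1, 0] ![0, 1] v := by
  have hl : ∀ t u, curl c t u v = t 0 • curl c ![1, 0] u v + t 1 • curl c ![0, 1] u v := by
    intro t u
    let f : (Fin 2 → ℤ) →+ R :=
      AddMonoidHom.mk' (fun t => curl c t u v) (fun t t' => curl_add_left hc t t' u v)
    have h : f t = f (t 0 • ![1, 0] + t 1 • ![0, 1]) := congrArg f (eq_smul_add_smul t)
    rw [map_add, map_zsmul, map_zsmul] at h
    exact h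
  rw [hl t u, curl_swap ![1, 0] u, curl_swap ![0, 1] u, hl u, hl u, curl_self, curl_self,
    curl_swap ![0, 1] ![1, 0]]
  simp only [planeDet, zsmul_eq_mul]
  push_cast
  ring

/-- A closed one-form on the grid is exact: integrate `a` in the first direction; closedness makes
the remaining error in `b` independent of `i`, so it can be integrated in the second. -/
theorem exists_potential (a b : ℤ → ℤ → R)
    (h : ∀ i j, a i (j + 1) - a i j = b (i + 1) j - b i j) :
    ∃ F : ℤ → ℤ → R, (∀ i j, F (i + 1) j - F i j = a i j) ∧
      ∀ i j, F i (j + 1) - F i j = b i j := by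
  obtain ⟨F₁, hF₁⟩ := exists_forward_difference a
  have h1 : ∀ i j, F₁ (i + 1) j - F₁ i j = a i j := fun i j => congrFun (hF₁ i) j
  have hb : ∀ i j, b i j - (F₁ i (j + 1) - F₁ i j) = b 0 j - (F₁ 0 (j + 1) - F₁ 0 j) := by
    intro i j
    refine eq_const_of_forward_difference_eq_zero (fun i => b i j - (F₁ i (j + 1) - F₁ i j)) ?_ i
    intro k
    linear_combination -(h k j) - h1 k (j + 1) + h1 k j
  obtain ⟨F₂, hF₂⟩ := exists_forward_difference fun j => b 0 j - (F₁ 0 (j + 1) - F₁ 0 j)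
  refine ⟨fun i j => F₁ i j + F₂ j, fun i j => ?_, fun i j => ?_⟩
  · linear_combination h1 i j
  · linear_combination hF₂ j - hb i j

/-- Normalised to vanish at the origin, the cocycle's values on the two basis vectors form a
one-form, closed because the curl vanishes. A potential solves the equation for the basis vectors,
and the `t` for which it holds form a subgroup. -/
theorem exists_eq_coboundary_of_curl_eq_zero (hc : IsPlaneCocycle c)
    (h0 : curl c ![1, 0] ![0, 1] 0 = 0) :
    ∃ y : PlaneDiff R, ∀ t v w, (c t).1 v w = y.1 (v - t) (w - t) - y.1 v w := by
  have hcurl : ∀ v, (c ![0, 1]).1 v (v - ![1, 0]) = (c ![1, 0]).1 v (v - ![0, 1]) := fun v =>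
    sub_eq_zero.1 ((curl_const hc ![1, 0] ![0, 1] v 0).trans h0)
  obtain ⟨F, hF1, hF2⟩ := exists_potential
    -- The sign and the unit shift convert the wanted backward differences `Y (v - e) - Y v` into
    -- forward ones.
    (fun i j => -(c ![1, 0]).1 0 ![i + 1, j]) (fun i j => -(c ![0, 1]).1 0 ![i, j + 1]) (by
      intro i j
      have h := hcurl ![i + 1, j + 1]
      have e1 : ![i + 1, j + 1] - ![1, 0] = ![i, j + 1] := by ext k; fin_cases k <;> simp
      have e2 : ![i + 1, j + 1] - ![0, 1] = ![i + 1, j] := by ext k; fin_cases k <;> simp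
      rw [e1, e2] at h
      have d1 := diff_add (c ![0, 1]) 0 ![i + 1, j + 1] ![i, j + 1]
      have d2 := diff_add (c ![1, 0]) 0 ![i + 1, j + 1] ![i + 1, j]
      linear_combination -h + d1 - d2)
  let Y : (Fin 2 → ℤ) → R := fun v => F (v 0) (v 1)
  have hY1 : ∀ v, Y (v - ![1, 0]) - Y v = (c ![1, 0]).1 0 v := by
    intro v
    have h := hF1 (v 0 - 1) (v 1)
    have e : ![v 0 - 1 + 1, v 1] = v := by ext k; fin_cases k <;> simp
    rw [e, sub_add_cancel] at h
    simp only [Y, Pi.sub_apply, Matrix.cons_val_zero, Matrix.cons_val_one, sub_zero]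
    linear_combination -h
  have hY2 : ∀ v, Y (v - ![0, 1]) - Y v = (c ![0, 1]).1 0 v := by
    intro v
    have h := hF2 (v 0) (v 1 - 1)
    have e : ![v 0, v 1 - 1 + 1] = v := by ext k; fin_cases k <;> simp
    rw [e, sub_add_cancel] at h
    simp only [Y, Pi.sub_apply, Matrix.cons_val_zero, Matrix.cons_val_one, sub_zero]
    linear_combination -h
  refine ⟨Diff.of Y, fun t => ?_⟩
  let B : AddSubgroup (Fin 2 → ℤ) :=
    { carrier := {t | ∀ v w, (c t).1 v w =
        (Diff.of Y : PlaneDiff R).1 (v - t) (w - t) - (Diff.of Y : PlaneDiff R).1 v w}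
      add_mem' := by
        intro t u ht hu v w
        rw [hc, ht, hu, sub_sub, sub_sub]
        ring
      zero_mem' := by
        intro v w
        have h := hc 0 0 v w
        simp only [add_zero, sub_zero] at h
        rw [sub_zero, sub_zero, sub_self]
        linear_combination -h
      neg_mem' := by
        intro t ht v w
        have h0 := hc 0 0 v w
        simp only [add_zero, sub_zero] at h0
        have h := hc (-t) t v w
        have h2 := ht (v - -t) (w - -t)
        rw [neg_add_cancel, h2, sub_sub, sub_sub, neg_add_cancel, sub_zero, sub_zero] at h
        linear_combination -h - h0 }
  have hB1 : ![1, 0] ∈ B := by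
    intro v w
    rw [← diff_add _ v 0 w, diff_swap _ v 0, ← hY1, ← hY1]
    change _ = (Y _ - Y _) - (Y _ - Y _)
    ring
  have hB2 : ![0, 1] ∈ B := by
    intro v w
    rw [← diff_add _ v 0 w, diff_swap _ v 0, ← hY2, ← hY2]
    change _ = (Y _ - Y _) - (Y _ - Y _)
    ring
  have ht : t ∈ B := by
    rw [eq_smul_add_smul t]
    exact B.add_mem (B.zsmul_mem hB1 _) (B.zsmul_mem hB2 _)
  exact ht

end Curl

/-! ### Extensions by the plane lattice and the invariant `lam` -/

/-- A group acting on the plane lattice by affine maps of determinant one, with the translations as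
a normal subgroup that has the stabiliser of the origin as a complement, together with a free
action on a pointed set. -/
structure PlaneExtension (G E S : Type) [Group G] [CommGroup E] where
  /-- the affine action on the plane lattice -/
  act : G →* Equiv.Perm (Fin 2 → ℤ)
  /-- the linear part of the affine action -/
  lin : G → (Fin 2 → ℤ) → Fin 2 → ℤ
  act_add : ∀ g v w, act g (v + w) = act g v + lin g w
  det_lin : ∀ g t u, planeDet (lin g t) (lin g u) = planeDet t u
  /-- the translations -/
  ι : Multiplicative (Fin 2 → ℤ) →* G
  act_ι : ∀ t v, act (ι t) v = t.toAdd + v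
  conj_ι : ∀ g t, g * ι t = ι (Multiplicative.ofAdd (lin g t.toAdd)) * g
  /-- the inclusion of the complement -/
  σ : E →* G
  act_σ : ∀ e, act (σ e) 0 = 0
  /-- the projection to the complement -/
  π : G →* E
  π_σ : ∀ e, π (σ e) = e
  π_ι : ∀ t, π (ι t) = 1
  ker_π : ∀ g, π g = 1 → ∃ t, g = ι t
  /-- the action on the pointed set -/
  b : G →* Equiv.Perm S
  free : ∀ g s, b g s = s → g = 1
  /-- the base point -/
  s₀ : S

namespace PlaneExtension

variable (R : Type) [CommRing R] {G E S : Type} [Group G] [CommGroup E] (D : PlaneExtension G E S)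

/-- Functions on the plane lattice up to constants. -/
def J : Representation R G (PlaneDiff R) := diffRep D.act (trivial R G R)

/-- The free module that contains `J`. -/
def I : Representation R G (S → PlaneDiff R) := funRep D.b (D.J R)

/-- The quotient of `I` by `J`. -/
def X : Representation R G (Diff R S (PlaneDiff R)) := diffRep D.b (D.J R)

/-- The translation by a vector. -/
def tr (t : Fin 2 → ℤ) : G := D.ι (Multiplicative.ofAdd t)

theorem tr_add (t u : Fin 2 → ℤ) : D.tr (t + u) = D.tr t * D.tr u := map_mul D.ι _ _

theorem tr_neg (t : Fin 2 → ℤ) : D.tr (-t) = (D.tr t)⁻¹ := map_inv D.ι _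

theorem act_tr (t v : Fin 2 → ℤ) : D.act (D.tr t) v = t + v := D.act_ι _ _

theorem conj_tr (g : G) (t : Fin 2 → ℤ) : g * D.tr t = D.tr (D.lin g t) * g := D.conj_ι _ _

variable {R}

theorem J_apply (g : G) (y : PlaneDiff R) (v w : Fin 2 → ℤ) :
    (D.J R g y).1 v w = y.1 (D.act g⁻¹ v) (D.act g⁻¹ w) := rfl

theorem J_tr_apply (t : Fin 2 → ℤ) (y : PlaneDiff R) (v w : Fin 2 → ℤ) :
    (D.J R (D.tr t) y).1 v w = y.1 (v - t) (w - t) := by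
  rw [J_apply, ← tr_neg, act_tr, act_tr, neg_add_eq_sub, neg_add_eq_sub]

theorem I_apply (g : G) (i : S → PlaneDiff R) (s : S) :
    D.I R g i s = D.J R g (i (D.b g⁻¹ s)) := rfl

theorem X_apply (g : G) (x : Diff R S (PlaneDiff R)) (s t : S) :
    (D.X R g x).1 s t = D.J R g (x.1 (D.b g⁻¹ s) (D.b g⁻¹ t)) := rfl

/-- The connecting cocycle of an element of `X` at a base point. -/
def cocycleAt (s : S) (x : Diff R S (PlaneDiff R)) (t : Fin 2 → ℤ) : PlaneDiff R :=
  x.1 (D.b (D.tr t) s) s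

/-- The elements of `X` that are fixed by translations. -/
def IsTranslationInvariant (x : Diff R S (PlaneDiff R)) : Prop :=
  ∀ t, D.X R (D.tr t) x = x

theorem IsTranslationInvariant.apply {D : PlaneExtension G E S}
    {x : Diff R S (PlaneDiff R)}
    (hx : D.IsTranslationInvariant x) (t : Fin 2 → ℤ) (s s' : S) :
    x.1 (D.b (D.tr t) s) (D.b (D.tr t) s') = D.J R (D.tr t) (x.1 s s') := by
  have h := congrArg (fun x => x.1 (D.b (D.tr t) s) (D.b (D.tr t) s')) (hx t)
  simp only [X_apply] at h
  rw [← h, ← Equiv.Perm.mul_apply, ← map_mul, ← Equiv.Perm.mul_apply, ← map_mul, inv_mul_cancel,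
    map_one, Equiv.Perm.one_apply, Equiv.Perm.one_apply]

/-- `cocycleAt` measures the failure of translation invariance of the lift of `x` to `I` that
vanishes at `s`. -/
theorem cocycleAt_isPlaneCocycle {x : Diff R S (PlaneDiff R)}
    (hx : D.IsTranslationInvariant x) (s : S) : IsPlaneCocycle (D.cocycleAt s x) := by
  intro t u v w
  have h : D.cocycleAt s x (t + u) = D.cocycleAt s x t + D.J R (D.tr t) (D.cocycleAt s x u) := by
    unfold cocycleAt
    rw [← hx.apply, tr_add, map_mul, Equiv.Perm.mul_apply, add_comm, diff_add]
  rw [h, ← D.J_tr_apply]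
  rfl

/-- The map from `X` to the coefficients that on invariants induces the second connecting map. -/
def lam : Diff R S (PlaneDiff R) →ₗ[R] R where
  toFun x := curl (D.cocycleAt D.s₀ x) ![1, 0] ![0, 1] 0
  map_add' x y := by
    simp only [curl, cocycleAt, Diff.add_apply]
    ring
  map_smul' r x := by
    simp only [curl, cocycleAt, Diff.smul_apply, smul_eq_mul, RingHom.id_apply]
    ring

theorem lam_eq (x : Diff R S (PlaneDiff R)) :
    D.lam x = curl (D.cocycleAt D.s₀ x) ![1, 0] ![0, 1] 0 := rfl

/-- The value of `lam` on translation invariant elements does not depend on the base point. -/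
theorem lam_eq_at {x : Diff R S (PlaneDiff R)} (hx : D.IsTranslationInvariant x) (s : S)
    (t u v : Fin 2 → ℤ) : curl (D.cocycleAt s x) t u v = planeDet t u • D.lam x := by
  rw [lam_eq, ← curl_eq_det_smul (D.cocycleAt_isPlaneCocycle hx _),
    curl_const (D.cocycleAt_isPlaneCocycle hx D.s₀) t u 0 v]
  -- A change of base point changes the cocycle by the coboundary of `x.1 s D.s₀`, and a coboundary
  -- has zero curl.
  have h : ∀ t v w, (D.cocycleAt s x t).1 v w = (D.cocycleAt D.s₀ x t).1 v w +
      ((x.1 s D.s₀).1 (v - t) (w - t) - (x.1 s D.s₀).1 v w) := by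
    intro t v w
    rw [← D.J_tr_apply, ← hx.apply]
    unfold cocycleAt
    rw [← diff_add x _ (D.b (D.tr t) D.s₀) s, ← diff_add x _ D.s₀ s, diff_swap x D.s₀ s]
    simp only [Diff.add_apply, Diff.neg_apply]
    ring
  have h1 := diff_add (x.1 s D.s₀) (v - t) (v - u) (v - u - t)
  have h2 := diff_add (x.1 s D.s₀) (v - t) (v - t - u) (v - u - t)
  have h3 := diff_add (x.1 s D.s₀) v (v - t) (v - u)
  rw [sub_right_comm v t u, diff_self] at h2
  simp only [curl, h]
  rw [sub_right_comm v t u]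
  linear_combination h1 - h2 - h3

theorem act_sub (g : G) (v t : Fin 2 → ℤ) : D.act g (v - t) = D.act g v - D.lin g t := by
  have h := D.act_add g (v - t) t
  rw [sub_add_cancel] at h
  rw [h, add_sub_cancel_right]

/-- The action of `g` moves the base point, which is harmless by `lam_eq_at`, and transforms the two
basis translations by a map of determinant one. -/
theorem lam_X (g : G) {x : Diff R S (PlaneDiff R)} (hx : D.IsTranslationInvariant x) :
    D.lam (D.X R g x) = D.lam x := by
  have h : ∀ t, D.cocycleAt D.s₀ (D.X R g x) t =
      D.J R g (D.cocycleAt (D.b g⁻¹ D.s₀) x (D.lin g⁻¹ t)) := by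
    intro t
    unfold cocycleAt
    rw [X_apply, ← Equiv.Perm.mul_apply, ← map_mul, conj_tr, map_mul, Equiv.Perm.mul_apply]
  rw [lam_eq]
  simp only [curl, h, J_apply, act_sub]
  have h2 := D.lam_eq_at hx (D.b g⁻¹ D.s₀) (D.lin g⁻¹ ![1, 0]) (D.lin g⁻¹ ![0, 1]) (D.act g⁻¹ 0)
  rw [D.det_lin] at h2
  refine h2.trans ?_
  simp [planeDet]

/-- With zero curl the connecting cocycle is the coboundary of some `y`; subtracting the constant
`y` from the lift `x.1 D.s₀` makes the lift invariant. -/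
theorem exists_invariant_of_lam_eq_zero {x : Diff R S (PlaneDiff R)}
    (hx : D.IsTranslationInvariant x) (h0 : D.lam x = 0) :
    ∃ i : S → PlaneDiff R, (∀ t, D.I R (D.tr t) i = i) ∧ ∀ s s', i s' - i s = x.1 s s' := by
  obtain ⟨y, hy⟩ := exists_eq_coboundary_of_curl_eq_zero (D.cocycleAt_isPlaneCocycle hx D.s₀) h0
  refine ⟨fun s => x.1 D.s₀ s - y, fun t => funext fun s => ?_, fun s s' => ?_⟩
  · have h1 : D.J R (D.tr t) (x.1 D.s₀ (D.b (D.tr t)⁻¹ s)) = x.1 (D.b (D.tr t) D.s₀) s := by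
      rw [← hx.apply, ← Equiv.Perm.mul_apply (D.b _), ← map_mul, mul_inv_cancel, map_one,
        Equiv.Perm.one_apply]
    have h2 : D.cocycleAt D.s₀ x t = D.J R (D.tr t) y - y := by
      ext v w
      rw [hy, ← D.J_tr_apply]
      rfl
    rw [I_apply, map_sub, h1, ← diff_add x _ D.s₀ s]
    change D.cocycleAt D.s₀ x t + _ - _ = _
    rw [h2]
    abel
  · rw [sub_sub_sub_cancel_right, ← diff_add x D.s₀ s s']
    abel

theorem lam_of_invariant {x : Diff R S (PlaneDiff R)} (i : S → PlaneDiff R)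
    (hi : ∀ t, D.I R (D.tr t) i = i) (h : ∀ s s', i s' - i s = x.1 s s') : D.lam x = 0 := by
  have hc : ∀ t v w, (D.cocycleAt D.s₀ x t).1 v w =
      (i D.s₀).1 v w - (i D.s₀).1 (v - t) (w - t) := by
    intro t v w
    have h1 : i (D.b (D.tr t) D.s₀) = D.J R (D.tr t) (i D.s₀) := by
      have := congrFun (hi t) (D.b (D.tr t) D.s₀)
      rw [I_apply, ← Equiv.Perm.mul_apply, ← map_mul, inv_mul_cancel, map_one,
        Equiv.Perm.one_apply] at this
      exact this.symm
    rw [cocycleAt, ← h, h1, ← D.J_tr_apply]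
    rfl
  have h1 := diff_add (i D.s₀) (0 - ![1, 0]) (0 - ![0, 1]) (0 - ![0, 1] - ![1, 0])
  have h2 := diff_add (i D.s₀) (0 - ![1, 0]) (0 - ![1, 0] - ![0, 1]) (0 - ![0, 1] - ![1, 0])
  have h3 := diff_add (i D.s₀) 0 (0 - ![1, 0]) (0 - ![0, 1])
  rw [sub_right_comm 0 ![1, 0] ![0, 1], diff_self] at h2
  rw [lam_eq]
  simp only [curl, hc]
  rw [sub_right_comm 0 ![1, 0] ![0, 1]]
  linear_combination -h1 + h2 + h3

theorem exists_lam_eq (r : R) :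
    ∃ x : Diff R S (PlaneDiff R), D.IsTranslationInvariant x ∧ D.lam x = r := by
  obtain ⟨c₀, hc₀⟩ := exists_equivariant_of_free D.b D.free
  let p : S → Fin 2 → ℤ := fun s => D.act (c₀ s) 0
  have hp : ∀ t s, p (D.b (D.tr t) s) = t + p s := by
    intro t s
    simp only [p, hc₀, map_mul, Equiv.Perm.mul_apply, act_tr]
  -- This encodes the bilinear cocycle `t₀ u₁`, which represents the determinant class. A
  -- translation changes `i s` by an element independent of `s`, so the differences of `i` are
  -- invariant.
  let i : S → PlaneDiff R := fun s => Diff.of fun v => -((p s 0 * v 1 : ℤ) : R) * r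
  have hi : ∀ s v w, (i s).1 v w = ((p s 0 * (v 1 - w 1) : ℤ) : R) * r := by
    intro s v w
    change -((p s 0 * w 1 : ℤ) : R) * r - -((p s 0 * v 1 : ℤ) : R) * r = _
    push_cast
    ring
  refine ⟨Diff.of i, fun t => ?_, ?_⟩
  · ext s s' v w
    rw [X_apply, J_tr_apply]
    change (i _).1 _ _ - (i _).1 _ _ = (i _).1 _ _ - (i _).1 _ _
    have h : ∀ s, p (D.b (D.tr t)⁻¹ s) = -t + p s := fun s => by rw [← tr_neg, hp]
    simp only [hi, h, Pi.add_apply, Pi.neg_apply, Pi.sub_apply]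
    push_cast
    ring
  · change ((i _).1 _ _ - (i _).1 _ _) - ((i _).1 _ _ - (i _).1 _ _) = r
    simp [hi, hp]
    ring

end PlaneExtension

/-! ### Crossed homomorphisms -/

section DegreeOne

variable {R G H V W : Type} [CommRing R] [Group G] [Group H] [AddCommGroup V] [Module R V]
  [AddCommGroup W] [Module R W]

/-- One-cocycles (crossed homomorphisms) with values in a representation. -/
def IsCrossedHom (ρ : Representation R G V) (f : G → V) : Prop :=
  ∀ g h, f (g * h) = ρ g (f h) + f g

/-- The cohomology class of a crossed homomorphism. -/
noncomputable def crossedClass (ρ : Representation R G V) (f : G → V) (hf : IsCrossedHom ρ f) :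
    coh ρ 1 :=
  (groupCohomology.H1π (Rep.of ρ)).hom
    ⟨f, (groupCohomology.mem_cocycles₁_iff (A := Rep.of ρ) f).2 hf⟩

theorem exists_crossedClass_eq (ρ : Representation R G V) (x : coh ρ 1) :
    ∃ f hf, crossedClass ρ f hf = x := by
  induction x using groupCohomology.H1_induction_on with
  | h z => exact ⟨z.1, (groupCohomology.mem_cocycles₁_iff (A := Rep.of ρ) z.1).1 z.2, rfl⟩

theorem crossedClass_eq_iff (ρ : Representation R G V) (f f' : G → V) (hf : IsCrossedHom ρ f)
    (hf' : IsCrossedHom ρ f') :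
    crossedClass ρ f hf = crossedClass ρ f' hf' ↔ ∃ v, ∀ g, f g - f' g = ρ g v - v := by
  refine (groupCohomology.H1π_eq_iff (A := Rep.of ρ) _ _).trans ?_
  constructor
  · rintro ⟨v, hv⟩
    exact ⟨v, fun g => (congrFun hv g).symm⟩
  · rintro ⟨v, hv⟩
    exact ⟨v, funext fun g => (hv g).symm⟩

theorem isCrossedHom_zero (ρ : Representation R G V) : IsCrossedHom ρ 0 := by
  intro g h
  simp

theorem crossedClass_zero (ρ : Representation R G V) :
    crossedClass ρ 0 (isCrossedHom_zero ρ) = 0 :=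
  map_zero (groupCohomology.H1π (Rep.of ρ)).hom

theorem IsCrossedHom.map {ρ : Representation R G V} {σ : Representation R H W} {f : G → V}
    (hf : IsCrossedHom ρ f) (j : H →* G) (φ : IntertwiningMap (ρ.comp j) σ) :
    IsCrossedHom σ (fun h => φ (f (j h))) := by
  intro g h
  change φ (f (j (g * h))) = _
  rw [map_mul, hf, map_add]
  exact congrArg (· + _) (φ.isIntertwining _ _ g (f (j h)))

theorem cohMap_crossedClass {ρ : Representation R G V} {σ : Representation R H W} {f : G → V}
    (hf : IsCrossedHom ρ f) (j : H →* G) (φ : IntertwiningMap (ρ.comp j) σ) :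
    cohMap j φ 1 (crossedClass ρ f hf) = crossedClass σ _ (hf.map j φ) :=
  congr($(groupCohomology.H1π_comp_map (A := Rep.of ρ) (B := Rep.of σ) j (Rep.ofHom φ))
    ⟨f, (groupCohomology.mem_cocycles₁_iff (A := Rep.of ρ) f).2 hf⟩)

theorem IsCrossedHom.exists_eq {ρ : Representation R G V} {f : G → V}
    (hf : IsCrossedHom ρ f) (h : Subsingleton (coh ρ 1)) : ∃ v, ∀ g, f g = ρ g v - v := by
  have := (crossedClass_eq_iff ρ f 0 hf (isCrossedHom_zero ρ)).1 (Subsingleton.elim _ _)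
  simpa using this

end DegreeOne

/-! ### Dimension shifting in four terms -/

section FourTerm

variable {R G V₁ V₂ V₃ V₄ : Type} [CommRing R] [Group G] [AddCommGroup V₁] [Module R V₁]
  [AddCommGroup V₂] [Module R V₂] [AddCommGroup V₃] [Module R V₃] [AddCommGroup V₄] [Module R V₄]

/-- Dimension shifting along an exact sequence with four terms. -/
theorem bijective_coeffMap_of_fourTerm {ρ₁ : Representation R G V₁} {ρ₂ : Representation R G V₂}
    {ρ₃ : Representation R G V₃} {ρ₄ : Representation R G V₄} (α : IntertwiningMap ρ₁ ρ₂)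
    (β : IntertwiningMap ρ₂ ρ₃) (γ : IntertwiningMap ρ₃ ρ₄) (hα : Function.Injective α)
    (hαβ : Function.Exact α β) (hβγ : Function.Exact β γ) (hγ : Function.Surjective γ)
    (h₂ : ∀ n, Subsingleton (coh ρ₂ (n + 1))) (n : ℕ) (h₁ : Subsingleton (coh ρ₁ (n + 2)))
    (h₁' : Subsingleton (coh ρ₁ (n + 3))) : Function.Bijective (coeffMap γ (n + 1)) := by
  let K := γ.ker
  let S : ShortExactSeq ρ₁ ρ₂ K.toRepresentation :=
    { i := α
      p := { toLinearMap := β.toLinearMap.codRestrict K.toSubmodule fun v => (hβγ _).2 ⟨v, rfl⟩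
             isIntertwining' := fun g => LinearMap.ext fun v =>
              Subtype.ext (β.isIntertwining _ _ g v) }
      inj := hα
      surj := fun ⟨x, hx⟩ => by
        obtain ⟨y, hy⟩ := (hβγ x).1 hx
        exact ⟨y, Subtype.ext hy⟩
      exact := fun x => Iff.trans Subtype.ext_iff (hαβ x) }
  let T : ShortExactSeq K.toRepresentation ρ₃ ρ₄ :=
    { i := { toLinearMap := K.toSubmodule.subtype
             isIntertwining' := fun g => rfl }
      p := γ
      inj := Subtype.val_injective
      surj := hγ
      exact := fun x => ⟨fun hx => ⟨⟨x, hx⟩, rfl⟩, by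
        rintro ⟨y, rfl⟩
        exact y.2⟩ }
  have hK : Subsingleton (coh K.toRepresentation (n + 1)) := S.subsingleton₃ (n + 1) (h₂ n) h₁
  have hK' : Subsingleton (coh K.toRepresentation (n + 1 + 1)) :=
    S.subsingleton₃ (n + 2) (h₂ (n + 1)) h₁'
  refine ⟨(injective_iff_map_eq_zero _).2 fun x hx => ?_, fun x => ?_⟩
  · obtain ⟨y, rfl⟩ := (T.exact₂ (n + 1) x).1 hx
    rw [Subsingleton.elim y 0, map_zero]
  · exact (T.exact₃ (n + 1) x).1 (Subsingleton.elim _ _)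

end FourTerm

/-! ### Translation invariants and reduction of `H¹(G, X)` to the complement -/

namespace PlaneExtension

variable {R : Type} [CommRing R] {G E S V W : Type} [Group G] [CommGroup E]
  (D : PlaneExtension G E S) [AddCommGroup V] [Module R V] [AddCommGroup W] [Module R W]

variable (R) in
/-- The presentation of `J`. -/
def seqJ : ShortExactSeq (trivial R G R) (funRep D.act (trivial R G R)) (D.J R) :=
  diffSeq D.act (trivial R G R)

variable (R) in
/-- The presentation of `X`. -/
def seqX : ShortExactSeq (D.J R) (D.I R) (D.X R) :=
  haveI : Nonempty S := ⟨D.s₀⟩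
  diffSeq D.b (D.J R)

theorem subsingleton_coh_I (n : ℕ) : Subsingleton (coh (D.I R) (n + 1)) :=
  subsingleton_coh_funRep_of_free _ _ D.free n

theorem eq_tr_mul (g : G) : ∃ t, g = D.tr t * D.σ (D.π g) := by
  obtain ⟨t, ht⟩ := D.ker_π (g * (D.σ (D.π g))⁻¹) (by rw [map_mul, map_inv, D.π_σ, mul_inv_cancel])
  exact ⟨t.toAdd, by rw [← mul_inv_eq_iff_eq_mul]; exact ht⟩

theorem tr_mul (g : G) (t : Fin 2 → ℤ) : D.tr t * g = g * D.tr (D.lin g⁻¹ t) := by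
  rw [← mul_right_inj g⁻¹, ← mul_assoc, D.conj_tr, inv_mul_cancel_right, inv_mul_cancel_left]

/-- The submodule of elements fixed by the translations. -/
def fixed (ρ : Representation R G V) : Submodule R V where
  carrier := {v | ∀ t, ρ (D.tr t) v = v}
  add_mem' hv hw t := by rw [map_add, hv t, hw t]
  zero_mem' t := map_zero _
  smul_mem' c v hv t := by rw [map_smul, hv t]

/-- The elements fixed by the translations. -/
def Fixed (ρ : Representation R G V) : Type := D.fixed ρ

instance (ρ : Representation R G V) : AddCommGroup (D.Fixed ρ) :=
  inferInstanceAs (AddCommGroup (D.fixed ρ))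

instance (ρ : Representation R G V) : Module R (D.Fixed ρ) :=
  inferInstanceAs (Module R (D.fixed ρ))

theorem Fixed.ext {D : PlaneExtension G E S} {ρ : Representation R G V} {v w : D.Fixed ρ}
    (h : v.1 = w.1) : v = w := Subtype.ext h

theorem apply_mem_fixed (ρ : Representation R G V) (g : G) {v : V} (hv : v ∈ D.fixed ρ) :
    ρ g v ∈ D.fixed ρ := by
  intro t
  rw [← Module.End.mul_apply, ← map_mul, tr_mul, map_mul, Module.End.mul_apply, hv]

theorem apply_eq_of_mem_fixed (ρ : Representation R G V) (g : G) {v : V} (hv : v ∈ D.fixed ρ) :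
    ρ (D.σ (D.π g)) v = ρ g v := by
  obtain ⟨t, ht⟩ := D.eq_tr_mul g
  conv_rhs => rw [ht, map_mul, Module.End.mul_apply]
  exact (D.apply_mem_fixed ρ _ hv t).symm

/-- The representation of the complement on the elements fixed by the translations. -/
def fixedRep (ρ : Representation R G V) : Representation R E (D.Fixed ρ) where
  toFun e := (ρ (D.σ e)).restrict fun _ hv => D.apply_mem_fixed ρ _ hv
  map_one' := LinearMap.ext fun v => Subtype.ext
    (congr($((congrArg ρ (map_one D.σ)).trans (map_one ρ)) v.1))
  map_mul' e e' := LinearMap.ext fun v => Subtype.ext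
    (congr($((congrArg ρ (map_mul D.σ e e')).trans (map_mul ρ _ _)) v.1))

/-- The map on fixed elements induced by an equivariant map. -/
def fixedMap {ρ : Representation R G V} {τ : Representation R G W} (φ : IntertwiningMap ρ τ) :
    IntertwiningMap (D.fixedRep ρ) (D.fixedRep τ) where
  toLinearMap := φ.toLinearMap.restrict fun v hv t => by
    have h := φ.isIntertwining _ _ (D.tr t) v
    rw [hv t] at h
    exact h.symm
  isIntertwining' e := LinearMap.ext fun v => Subtype.ext (φ.isIntertwining _ _ _ v.1)

/-- An equivariant map `S → G` followed by `π` is equivariant over `E` and unchanged by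
translations, so averaging along it preserves invariants. -/
theorem subsingleton_coh_fixedRep_I (n : ℕ) :
    Subsingleton (coh (D.fixedRep (D.I R)) (n + 1)) := by
  obtain ⟨c, hc⟩ := exists_equivariant_of_free D.b D.free
  refine subsingleton_coh_of_average (D.fixedRep (D.I R))
    { toFun := fun φ => ⟨fun s => (φ (D.π (c s))).1 s, fun t => funext fun s => ?_⟩
      map_add' := fun _ _ => rfl
      map_smul' := fun _ _ => rfl }
    (fun _ => rfl) (fun e φ => Subtype.ext <| funext fun s => ?_) n
  · have h : D.π (c (D.b (D.tr t)⁻¹ s)) = D.π (c s) := by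
      rw [hc, map_mul, map_inv, tr, D.π_ι, inv_one, one_mul]
    have h2 := congrFun ((φ (D.π (c s))).2 t) s
    rw [I_apply] at h2 ⊢
    rw [h, h2]
  · change D.J R (D.σ e) ((φ (e⁻¹ * D.π (c s))).1 (D.b (D.σ e)⁻¹ s)) =
      D.J R (D.σ e) ((φ (D.π (c (D.b (D.σ e)⁻¹ s)))).1 (D.b (D.σ e)⁻¹ s))
    have h : D.π (c (D.b (D.σ e)⁻¹ s)) = e⁻¹ * D.π (c s) := by rw [hc, map_mul, map_inv, D.π_σ]
    exact congrArg (fun a => D.J R (D.σ e) ((φ a).1 (D.b (D.σ e)⁻¹ s))) h.symm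

/-- The map `lam` on invariants. -/
def lamFixed : IntertwiningMap (D.fixedRep (D.X R)) (trivial R E R) where
  toLinearMap := D.lam ∘ₗ (D.fixed (D.X R)).subtype
  isIntertwining' e := LinearMap.ext fun x => D.lam_X (D.σ e) x.2

/-- With `T` the translations, `0 → Jᵀ → Iᵀ → Xᵀ → R → 0` is exact, its last term being `H¹(T, J) ≅
H²(T, R) ≅ R`; moreover `Iᵀ` is acyclic. -/
theorem bijective_coeffMap_lamFixed (h2 : Subsingleton (coh (D.fixedRep (D.J R)) 2))
    (h3 : Subsingleton (coh (D.fixedRep (D.J R)) 3)) :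
    Function.Bijective (coeffMap (D.lamFixed (R := R)) 1) := by
  refine bijective_coeffMap_of_fourTerm (D.fixedMap (D.seqX R).i) (D.fixedMap (D.seqX R).p)
    (D.lamFixed (R := R)) (fun x y h => Subtype.ext ((D.seqX R).inj (congrArg Subtype.val h)))
    (fun x => ?_) (fun x => ?_) (fun r => ?_) D.subsingleton_coh_fixedRep_I 0 h2 h3
  · constructor
    · intro hx
      obtain ⟨y, hy⟩ := ((D.seqX R).exact x.1).1 (congrArg Subtype.val hx)
      refine ⟨⟨y, fun t => (D.seqX R).inj ?_⟩, Subtype.ext hy⟩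
      rw [(D.seqX R).i.isIntertwining, hy, x.2 t]
    · rintro ⟨y, rfl⟩
      exact Subtype.ext (((D.seqX R).exact _).2 ⟨y.1, rfl⟩)
  · constructor
    · intro hx
      obtain ⟨i, hi, h⟩ := D.exists_invariant_of_lam_eq_zero x.2 hx
      exact ⟨⟨i, hi⟩, Subtype.ext (Diff.ext h)⟩
    · rintro ⟨i, rfl⟩
      exact D.lam_of_invariant i.1 i.2 fun _ _ => rfl
  · obtain ⟨x, hx, h⟩ := D.exists_lam_eq r
    exact ⟨⟨x, hx⟩, h⟩

theorem ι_injective : Function.Injective D.ι := fun t u h => by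
  have h1 := D.act_ι t 0
  rw [h, D.act_ι] at h1
  exact Multiplicative.toAdd.injective (by simpa using h1.symm)

/-- Two dimension shifts embed this group in `H³(ℤ², R) = 0`. They apply because the translations
act freely on both the plane lattice and `S`. -/
theorem subsingleton_coh_X_translations : Subsingleton (coh ((D.X R).comp D.ι) 1) := by
  have hZ : Subsingleton (coh (trivial R (Multiplicative (Fin 2 → ℤ)) R) 3) :=
    subsingleton_coh_of_section (AddMonoidHom.toMultiplicative (Pi.evalAddMonoidHom _ 0))
      (AddMonoidHom.toMultiplicative (Pi.evalAddMonoidHom _ 1))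
      (fun i j => Multiplicative.ofAdd ![j, i])
      (fun g i j => Multiplicative.toAdd.injective (by ext k; fin_cases k <;> rfl)) _ 0
  have hJ : Subsingleton (coh ((D.J R).comp D.ι) 2) := by
    rw [J, diffRep_comp]
    exact (diffSeq (D.act.comp D.ι) (trivial R (Multiplicative (Fin 2 → ℤ)) R)).subsingleton₃ 2
      (subsingleton_coh_funRep_of_free _ _ (fun t v h => by
        have h1 := D.act_ι t v
        rw [show D.act (D.ι t) v = v from h] at h1
        exact Multiplicative.toAdd.injective (by simpa using h1)) 1) hZ
  have : Nonempty S := ⟨D.s₀⟩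
  rw [X, diffRep_comp]
  exact (diffSeq (D.b.comp D.ι) ((D.J R).comp D.ι)).subsingleton₃ 1
    (subsingleton_coh_funRep_of_free _ _ (fun t s h => D.ι_injective
      ((D.free _ _ h).trans (map_one D.ι).symm)) 0) hJ

variable (R) in
/-- Crossed homomorphisms to `X` that vanish on the translations. -/
structure IsNormalized (f : G → Diff R S (PlaneDiff R)) : Prop where
  crossed : IsCrossedHom (D.X R) f
  tr_eq_zero : ∀ t, f (D.tr t) = 0

variable {D}

/-- Compare the values of `f` on the two sides of `t g = g t'`, with `t'` the conjugate translation.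
-/
theorem IsNormalized.mem_fixed {f : G → Diff R S (PlaneDiff R)}
    (hf : D.IsNormalized R f) (g : G) : f g ∈ D.fixed (D.X R) := by
  intro t
  have h1 := hf.crossed (D.tr t) g
  have h2 := hf.crossed g (D.tr (D.lin g⁻¹ t))
  rw [hf.tr_eq_zero, add_zero] at h1
  rw [hf.tr_eq_zero, map_zero, zero_add, ← tr_mul] at h2
  rw [← h1, h2]

theorem IsNormalized.apply_σ_π {f : G → Diff R S (PlaneDiff R)}
    (hf : D.IsNormalized R f) (g : G) : f (D.σ (D.π g)) = f g := by
  obtain ⟨t, ht⟩ := D.eq_tr_mul g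
  have h1 := hf.crossed (D.tr t) (D.σ (D.π g))
  rw [← ht, hf.tr_eq_zero, add_zero, hf.mem_fixed] at h1
  exact h1.symm

theorem IsNormalized.lam_mul {f : G → Diff R S (PlaneDiff R)}
    (hf : D.IsNormalized R f) (g h : G) : D.lam (f (g * h)) = D.lam (f g) + D.lam (f h) := by
  rw [hf.crossed, map_add, D.lam_X g (hf.mem_fixed h), add_comm]

variable (D)

/-- Every class in `H¹(G, X)` comes from a normalized crossed homomorphism. -/
theorem exists_isNormalized (x : coh (D.X R) 1) :
    ∃ f, ∃ hf : D.IsNormalized R f, crossedClass (D.X R) f hf.crossed = x := by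
  obtain ⟨f, hf, rfl⟩ := exists_crossedClass_eq (D.X R) x
  obtain ⟨v, hv⟩ := IsCrossedHom.exists_eq (ρ := (D.X R).comp D.ι) (f := fun t => f (D.ι t))
    (fun t u => (congrArg f (map_mul D.ι t u)).trans (hf _ _)) D.subsingleton_coh_X_translations
  have hc : IsCrossedHom (D.X R) fun g => f g - (D.X R g v - v) := fun g h => by
    simp only
    rw [hf, map_sub, map_sub, map_mul, Module.End.mul_apply]
    abel
  refine ⟨fun g => f g - (D.X R g v - v), ⟨hc, fun t => sub_eq_zero.2 (hv _)⟩, ?_⟩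
  exact (crossedClass_eq_iff _ _ _ _ _).2 ⟨-v, fun g => by
    rw [map_neg]
    abel⟩

/-- Every homomorphism from the complement is the `lam` of a normalized crossed homomorphism. -/
theorem exists_isNormalized_lam (h2 : Subsingleton (coh (D.fixedRep (D.J R)) 2))
    (h3 : Subsingleton (coh (D.fixedRep (D.J R)) 3)) (φ : E → R)
    (hφ : ∀ a b, φ (a * b) = φ a + φ b) :
    ∃ f, D.IsNormalized R f ∧ ∀ g, D.lam (f g) = φ (D.π g) := by
  have hc : IsCrossedHom (trivial R E R) φ := fun a b => (hφ a b).trans (add_comm _ _)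
  obtain ⟨y, hy⟩ := (D.bijective_coeffMap_lamFixed h2 h3).2 (crossedClass _ φ hc)
  obtain ⟨u, hu, rfl⟩ := exists_crossedClass_eq _ y
  rw [coeffMap, cohMap_crossedClass, crossedClass_eq_iff] at hy
  obtain ⟨v, hv⟩ := hy
  refine ⟨fun g => (u (D.π g)).1, ⟨fun g h => ?_, fun t => ?_⟩, fun g => ?_⟩
  · have h1 := congrArg Subtype.val (hu (D.π g) (D.π h))
    rw [map_mul, h1]
    exact congrArg (· + _) (D.apply_eq_of_mem_fixed _ _ (u _).2)
  · have h1 := hu 1 1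
    rw [mul_one, map_one, Module.End.one_apply, left_eq_add] at h1
    rw [tr, D.π_ι, h1]
    rfl
  · exact sub_eq_zero.1 ((hv (D.π g)).trans (sub_self v))

/-- A normalized crossed homomorphism is determined up to coboundaries by its `lam`. -/
theorem crossedClass_eq_zero_of_lam (h2 : Subsingleton (coh (D.fixedRep (D.J R)) 2))
    (h3 : Subsingleton (coh (D.fixedRep (D.J R)) 3)) {f : G → Diff R S (PlaneDiff R)}
    (hf : D.IsNormalized R f) (hl : ∀ g, D.lam (f g) = 0) :
    crossedClass (D.X R) f hf.crossed = 0 := by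
  let u : E → D.Fixed (D.X R) := fun e => ⟨f (D.σ e), hf.mem_fixed _⟩
  have hu : IsCrossedHom (D.fixedRep (D.X R)) u := fun a b => Subtype.ext (by
    change f (D.σ (a * b)) = _
    rw [map_mul, hf.crossed]
    rfl)
  have h := (injective_iff_map_eq_zero _).1 (D.bijective_coeffMap_lamFixed h2 h3).1
    (crossedClass _ u hu) (by
      rw [coeffMap, cohMap_crossedClass, ← crossedClass_zero, crossedClass_eq_iff]
      exact ⟨0, fun e => by
        rw [map_zero, sub_zero, Pi.zero_apply, sub_zero]
        exact hl _⟩)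
  rw [← crossedClass_zero, crossedClass_eq_iff] at h
  obtain ⟨v, hv⟩ := h
  rw [← crossedClass_zero, crossedClass_eq_iff]
  refine ⟨v.1, fun g => ?_⟩
  have := congrArg Subtype.val (hv (D.π g))
  rw [← hf.apply_σ_π, ← apply_eq_of_mem_fixed _ _ _ v.2]
  exact this

end PlaneExtension

section CrossedAdd

variable {R G V : Type} [CommRing R] [Group G] [AddCommGroup V] [Module R V]

theorem IsCrossedHom.add {ρ : Representation R G V} {f f' : G → V} (hf : IsCrossedHom ρ f)
    (hf' : IsCrossedHom ρ f') : IsCrossedHom ρ (f + f') := by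
  intro g h
  simp only [Pi.add_apply, hf g h, hf' g h, map_add]
  abel

theorem crossedClass_add {ρ : Representation R G V} {f f' : G → V} (hf : IsCrossedHom ρ f)
    (hf' : IsCrossedHom ρ f') : crossedClass ρ (f + f') (hf.add hf') =
      crossedClass ρ f hf + crossedClass ρ f' hf' :=
  map_add (groupCohomology.H1π (Rep.of ρ)).hom
    ⟨f, (groupCohomology.mem_cocycles₁_iff (A := Rep.of ρ) f).2 hf⟩
    ⟨f', (groupCohomology.mem_cocycles₁_iff (A := Rep.of ρ) f').2 hf'⟩

variable (R) in
/-- The identity, as a map between trivial representations along a group homomorphism. -/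
def trivialMap {H : Type} [Group H] (j : H →* G) :
    IntertwiningMap (MonoidHom.comp (trivial R G R) j) (trivial R H R) where
  toLinearMap := LinearMap.id
  isIntertwining' _ := rfl

end CrossedAdd

/-! ### Splitting `H³(G)` into inflated classes and `H¹(G, X)` -/

namespace PlaneExtension

variable {R : Type} [CommRing R] {G E S : Type} [Group G] [CommGroup E]
  (D : PlaneExtension G E S)

variable (R) in
/-- The pullback from the complement. -/
noncomputable def inflation (n : ℕ) : coh (trivial R E R) n →ₗ[R] coh (trivial R G R) n :=
  cohMap D.π (trivialMap R D.π) n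

variable (R) in
/-- Evaluation at the origin. -/
def evalZero : IntertwiningMap (MonoidHom.comp (funRep D.act (trivial R G R)) D.σ)
    (trivial R E R) where
  toLinearMap := LinearMap.proj 0
  isIntertwining' e := LinearMap.ext fun F => by
    change F (D.act (D.σ e)⁻¹ 0) = F 0
    rw [← map_inv, D.act_σ]

theorem evalZero_inflation (n : ℕ) (z : coh (trivial R E R) n) :
    cohMap D.σ (D.evalZero R) n (coeffMap (D.seqJ R).i n (D.inflation R n z)) = z := by
  have h1 := cohMap_comp D.π (MonoidHom.id G) (trivialMap R D.π) (D.seqJ R).i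
    { toLinearMap := LinearMap.pi fun _ => LinearMap.id
      isIntertwining' := fun g => rfl } (fun _ => rfl) n z
  have h2 := cohMap_comp (D.π.comp (MonoidHom.id G)) D.σ
    { toLinearMap := LinearMap.pi fun _ => LinearMap.id
      isIntertwining' := fun g => rfl } (D.evalZero R)
    { toLinearMap := LinearMap.id
      isIntertwining' := fun g => rfl } (fun _ => rfl) n z
  rw [inflation, coeffMap, h1, h2]
  have h3 : (D.π.comp (MonoidHom.id G)).comp D.σ = MonoidHom.id E := MonoidHom.ext D.π_σ
  rw [cohMap_congr h3 _ (IntertwiningMap.id (trivial R E R)) (fun _ => rfl), cohMap_id]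

/-- Evaluation at the origin gives injectivity. By Shapiro the target is abstractly isomorphic to
the finite source, so surjectivity follows without identifying the Shapiro isomorphism. -/
theorem bijective_coeffMap_inflation (n : ℕ) [Finite (coh (trivial R E R) n)] :
    Function.Bijective fun z => coeffMap (D.seqJ R).i n (D.inflation R n z) := by
  have hinj : Function.Injective fun z => coeffMap (D.seqJ R).i n (D.inflation R n z) :=
    Function.LeftInverse.injective (D.evalZero_inflation n)
  obtain ⟨s⟩ := nonempty_coh_funRep_equiv (R := R) D.act 0
    (fun v => ⟨D.tr v, by rw [act_tr, add_zero]⟩) D.σ (Function.LeftInverse.injective D.π_σ)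
    (fun g => by
      constructor
      · intro hg
        obtain ⟨t, ht⟩ := D.eq_tr_mul g
        rw [ht, map_mul, Equiv.Perm.mul_apply, D.act_σ, act_tr, add_zero] at hg
        rw [hg] at ht
        exact ⟨D.π g, by rw [ht, tr, ofAdd_zero, map_one, one_mul, D.π_σ]⟩
      · rintro ⟨e, rfl⟩
        exact D.act_σ e) n
  refine ⟨hinj, fun x => ?_⟩
  obtain ⟨z, hz⟩ := Finite.surjective_of_injective (s.injective.comp hinj) (s x)
  exact ⟨z, s.injective hz⟩

variable (R) in
/-- The iterated connecting map from degree one to degree three. -/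
noncomputable def doubleDelta : coh (D.X R) 1 →ₗ[R] coh (trivial R G R) 3 :=
  (D.seqJ R).δ 2 ∘ₗ (D.seqX R).δ 1

theorem coeffMap_doubleDelta (x : coh (D.X R) 1) :
    coeffMap (D.seqJ R).i 3 (D.doubleDelta R x) = 0 :=
  ((D.seqJ R).exact₁ 2 _).2 ⟨_, rfl⟩

/-- Inflation splits the map from `H³(G, R)` to the cohomology of functions on the plane, whose
kernel is the image of the connecting map from `H²(G, J)`. That connecting map is injective, since
in degree two every class of functions already comes from `H²(G, R)`. Acyclicity of `I` identifies
`H²(G, J)` with `H¹(G, X)`. -/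
theorem bijective_doubleDelta_add_inflation [Finite (coh (trivial R E R) 2)]
    [Finite (coh (trivial R E R) 3)] :
    Function.Bijective ((D.doubleDelta R).coprod (D.inflation R 3)) := by
  have hinj : Function.Injective (D.doubleDelta R) := by
    refine ((D.seqJ R).δ_injective 2 fun x => ?_).comp
      ((D.seqX R).δ_injective_of_subsingleton 1 (D.subsingleton_coh_I 0))
    obtain ⟨z, rfl⟩ := (D.bijective_coeffMap_inflation 2).2 x
    exact ((D.seqJ R).exact₂ 2 _).2 ⟨_, rfl⟩
  constructor
  · refine (injective_iff_map_eq_zero _).2 fun ⟨x, z⟩ h => ?_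
    rw [LinearMap.coprod_apply] at h
    have hz : z = 0 := by
      refine (D.bijective_coeffMap_inflation 3).1 ?_
      have := congrArg (coeffMap (D.seqJ R).i 3) h
      rw [map_add, coeffMap_doubleDelta, zero_add, map_zero] at this
      simp only [this, map_zero]
    subst hz
    rw [map_zero, add_zero] at h
    rw [(injective_iff_map_eq_zero _).1 hinj x h]
    rfl
  · intro y
    obtain ⟨z, hz⟩ := (D.bijective_coeffMap_inflation 3).2 (coeffMap (D.seqJ R).i 3 y)
    obtain ⟨w, hw⟩ := ((D.seqJ R).exact₁ 2 (y - D.inflation R 3 z)).1 (by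
      rw [map_sub, sub_eq_zero]
      exact hz.symm)
    obtain ⟨x, rfl⟩ := (D.seqX R).δ_surjective 1 (D.subsingleton_coh_I 1) w
    refine ⟨(x, z), ?_⟩
    rw [LinearMap.coprod_apply]
    exact (congrArg (· + _) hw).trans (sub_add_cancel _ _)

theorem IsNormalized.add {D : PlaneExtension G E S} {f f' : G → Diff R S (PlaneDiff R)}
    (hf : D.IsNormalized R f) (hf' : D.IsNormalized R f') : D.IsNormalized R (f + f') :=
  ⟨hf.crossed.add hf'.crossed, fun t => by
    rw [Pi.add_apply, hf.tr_eq_zero, hf'.tr_eq_zero, add_zero]⟩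

/-- The two differ by the coboundary of some `v`; vanishing on translations makes `v` invariant, and
then `lam` does not see the coboundary. -/
theorem lam_eq_of_crossedClass_eq {D : PlaneExtension G E S} {f f' : G → Diff R S (PlaneDiff R)}
    (hf : D.IsNormalized R f) (hf' : D.IsNormalized R f')
    (h : crossedClass (D.X R) f hf.crossed = crossedClass (D.X R) f' hf'.crossed) (g : G) :
    D.lam (f g) = D.lam (f' g) := by
  obtain ⟨v, hv⟩ := (crossedClass_eq_iff _ _ _ _ _).1 h
  have hv' : D.IsTranslationInvariant v := fun t => by
    have := hv (D.tr t)
    rw [hf.tr_eq_zero, hf'.tr_eq_zero, sub_self] at this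
    exact (sub_eq_zero.1 this.symm)
  rw [← sub_eq_zero, ← map_sub, hv, map_sub, D.lam_X g hv', sub_self]

variable (R) in
/-- The value at a group element of the homomorphism that belongs to a class in `H¹(G, X)`. -/
noncomputable def lamAt (g : G) : coh (D.X R) 1 →+ R :=
  AddMonoidHom.mk' (fun x => D.lam ((D.exists_isNormalized x).choose g)) fun x y => by
    obtain ⟨hx, ex⟩ := (D.exists_isNormalized x).choose_spec
    obtain ⟨hy, ey⟩ := (D.exists_isNormalized y).choose_spec
    obtain ⟨hxy, exy⟩ := (D.exists_isNormalized (x + y)).choose_spec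
    rw [← map_add, ← Pi.add_apply]
    refine lam_eq_of_crossedClass_eq hxy (hx.add hy) ?_ g
    rw [exy, crossedClass_add hx.crossed hy.crossed, ex, ey]

theorem lamAt_crossedClass {f : G → Diff R S (PlaneDiff R)} (hf : D.IsNormalized R f) (g : G) :
    D.lamAt R g (crossedClass (D.X R) f hf.crossed) = D.lam (f g) :=
  have h := (D.exists_isNormalized (crossedClass (D.X R) f hf.crossed)).choose_spec
  lam_eq_of_crossedClass_eq h.choose hf h.choose_spec g

theorem lamAt_mul (g h : G) (x : coh (D.X R) 1) :
    D.lamAt R (g * h) x = D.lamAt R g x + D.lamAt R h x := by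
  obtain ⟨f, hf, rfl⟩ := D.exists_isNormalized x
  simp only [D.lamAt_crossedClass hf, hf.lam_mul]

/-- `H¹(G, X)` is `Hom(E, R)`, and the conditions on `s` and `φ₁` say that evaluation at `s`
identifies `Hom(E, R)` with `R`. -/
theorem bijective_lamAt (h2 : Subsingleton (coh (D.fixedRep (D.J R)) 2))
    (h3 : Subsingleton (coh (D.fixedRep (D.J R)) 3)) (s : E)
    (hs : ∀ φ : E → R, (∀ a b, φ (a * b) = φ a + φ b) → φ s = 0 → ∀ a, φ a = 0)
    (φ₁ : E → R) (hφ₁ : ∀ a b, φ₁ (a * b) = φ₁ a + φ₁ b) (hs₁ : φ₁ s = 1) :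
    Function.Bijective (D.lamAt R (D.σ s)) := by
  constructor
  · refine (injective_iff_map_eq_zero _).2 fun x hx => ?_
    obtain ⟨f, hf, rfl⟩ := D.exists_isNormalized x
    rw [D.lamAt_crossedClass hf] at hx
    refine D.crossedClass_eq_zero_of_lam h2 h3 hf fun g => ?_
    rw [← hf.apply_σ_π]
    exact hs (fun a => D.lam (f (D.σ a))) (fun a b => by rw [map_mul, hf.lam_mul]) hx _
  · intro r
    obtain ⟨f, hf, h⟩ := D.exists_isNormalized_lam h2 h3 (fun a => φ₁ a * r)
      (fun a b => by rw [hφ₁, add_mul])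
    exact ⟨_, (D.lamAt_crossedClass hf _).trans (by rw [h, D.π_σ, hs₁, one_mul])⟩

/-! ### Compatibility with restriction -/

section Restriction

variable {G' E' : Type} [Group G'] [CommGroup E'] (D' : PlaneExtension G' E' S) (j : G' →* G)

/-- Compatibility of two plane extensions along a group homomorphism. -/
structure IsRestriction : Prop where
  act_eq : ∀ g, D'.act g = D.act (j g)
  b_eq : ∀ g, D'.b g = D.b (j g)
  ι_eq : ∀ t, D.ι t = j (D'.ι t)
  s₀_eq : D'.s₀ = D.s₀

variable {D D' j}

theorem IsRestriction.J_eq (h : D.IsRestriction D' j) (g : G') (y : PlaneDiff R) :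
    D.J R (j g) y = D'.J R g y :=
  Diff.ext fun v w => by rw [J_apply, J_apply, h.act_eq, map_inv j]

theorem IsRestriction.lam_eq (h : D.IsRestriction D' j) (x : Diff R S (PlaneDiff R)) :
    D'.lam x = D.lam x := by
  rw [PlaneExtension.lam_eq, PlaneExtension.lam_eq]
  unfold cocycleAt tr
  simp only [h.b_eq, h.ι_eq, h.s₀_eq]

variable (R) in
/-- The identity of `J`, as a map along `j`. -/
def IsRestriction.mapJ (h : D.IsRestriction D' j) :
    IntertwiningMap (MonoidHom.comp (D.J R) j) (D'.J R) where
  toLinearMap := LinearMap.id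
  isIntertwining' g := LinearMap.ext fun y => h.J_eq g y

variable (R) in
/-- The identity of `I`, as a map along `j`. -/
def IsRestriction.mapI (h : D.IsRestriction D' j) :
    IntertwiningMap (MonoidHom.comp (D.I R) j) (D'.I R) where
  toLinearMap := LinearMap.id
  isIntertwining' g := LinearMap.ext fun i => funext fun s => by
    change D.J R (j g) (i (D.b (j g)⁻¹ s)) = D'.J R g (i (D'.b g⁻¹ s))
    rw [h.J_eq, h.b_eq, map_inv j]

variable (R) in
/-- The identity of `X`, as a map along `j`. -/
def IsRestriction.mapX (h : D.IsRestriction D' j) :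
    IntertwiningMap (MonoidHom.comp (D.X R) j) (D'.X R) where
  toLinearMap := LinearMap.id
  isIntertwining' g := LinearMap.ext fun x => Diff.ext fun s t => by
    change D.J R (j g) (x.1 (D.b (j g)⁻¹ s) (D.b (j g)⁻¹ t)) =
      D'.J R g (x.1 (D'.b g⁻¹ s) (D'.b g⁻¹ t))
    rw [h.J_eq, h.b_eq, map_inv j]

/-- Both extensions use the same lattice and the same set `S`, so all comparison maps are
identities, and naturality applies to each connecting map. -/
theorem IsRestriction.cohMap_doubleDelta (h : D.IsRestriction D' j) (x : coh (D.X R) 1) :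
    cohMap j (trivialMap R j) 3 (D.doubleDelta R x) =
      D'.doubleDelta R (cohMap j (h.mapX R) 1 x) := by
  refine (ShortExactSeq.δ_naturality (D.seqJ R) (D'.seqJ R) j (trivialMap R j)
    { toLinearMap := LinearMap.id
      isIntertwining' := fun g => LinearMap.ext fun F => funext fun v => by
        change F (D.act (j g)⁻¹ v) = F (D'.act g⁻¹ v)
        rw [h.act_eq, map_inv j] } (h.mapJ R) (fun _ => rfl) (fun _ => rfl) 2 _).trans ?_
  exact congrArg ((D'.seqJ R).δ 2) (ShortExactSeq.δ_naturality (D.seqX R) (D'.seqX R) j (h.mapJ R)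
    (h.mapI R) (h.mapX R) (fun _ => rfl) (fun _ => rfl) 1 x)

theorem IsRestriction.lamAt_cohMap (h : D.IsRestriction D' j) (g : G') (x : coh (D.X R) 1) :
    D'.lamAt R g (cohMap j (h.mapX R) 1 x) = D.lamAt R (j g) x := by
  obtain ⟨f, hf, rfl⟩ := D.exists_isNormalized x
  rw [D.lamAt_crossedClass hf, cohMap_crossedClass]
  refine (D'.lamAt_crossedClass (f := fun g => f (j g))
    ⟨hf.crossed.map j (h.mapX R), fun t => ?_⟩ g).trans (h.lam_eq _)
  rw [tr, ← h.ι_eq]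
  exact hf.tr_eq_zero t

end Restriction

end PlaneExtension

/-! ### Homomorphisms from the complement and the restriction map -/

namespace PlaneExtension

section Classification

variable {R : Type} [CommRing R] [IsDomain R] [CharZero R] {E : Type} [CommGroup E]

/-- Each `a` differs from a power of `s` by an element of the finite kernel, and torsion goes to
zero in a domain of characteristic zero. -/
theorem additive_eq_mul (e : E →* Multiplicative ℤ) [Finite e.ker] (s : E)
    (hs : e s = Multiplicative.ofAdd 1) (φ : E → R) (hφ : ∀ a b, φ (a * b) = φ a + φ b) (a : E) :
    φ a = ((e a).toAdd : R) * φ s := by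
  let f : E →* Multiplicative R := MonoidHom.mk' (fun a => Multiplicative.ofAdd (φ a)) hφ
  have hf : ∀ a, φ a = (f a).toAdd := fun _ => rfl
  have hb : a * (s ^ (e a).toAdd)⁻¹ ∈ e.ker := by
    rw [MonoidHom.mem_ker, map_mul, map_inv, map_zpow, hs]
    refine Multiplicative.toAdd.injective ?_
    simp
  obtain ⟨k, hk, h1⟩ := isOfFinOrder_iff_pow_eq_one.1
    (isOfFinOrder_of_finite (⟨_, hb⟩ : e.ker))
  have h2 : (a * (s ^ (e a).toAdd)⁻¹) ^ k = 1 := congrArg Subtype.val h1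
  have h3 := congrArg (fun a => (f a).toAdd) h2
  simp only [map_pow, map_mul, map_inv, map_zpow, map_one, toAdd_pow, toAdd_mul, toAdd_inv,
    toAdd_zpow, toAdd_one, ← hf, nsmul_eq_mul, zsmul_eq_mul, mul_eq_zero, Nat.cast_eq_zero,
    hk.ne', false_or] at h3
  linear_combination h3

variable {G G' E' S : Type} [Group G] [Group G'] [CommGroup E']
  {D : PlaneExtension G E S} {D' : PlaneExtension G' E' S} {j : G' →* G}

theorem bijective_lamAt_of_hom (D : PlaneExtension G E S)
    (h2 : Subsingleton (coh (D.fixedRep (D.J R)) 2))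
    (h3 : Subsingleton (coh (D.fixedRep (D.J R)) 3)) (e : E →* Multiplicative ℤ) [Finite e.ker]
    (s : E) (hs : e s = Multiplicative.ofAdd 1) : Function.Bijective (D.lamAt R (D.σ s)) := by
  refine D.bijective_lamAt h2 h3 s (fun φ hφ h a => ?_) (fun a => ((e a).toAdd : R)) (fun a b => ?_)
    ?_
  · rw [additive_eq_mul e s hs φ hφ, h, mul_zero]
  · rw [map_mul, toAdd_mul, Int.cast_add]
  · rw [hs, toAdd_ofAdd, Int.cast_one]

/-- The third cohomology of two compatible plane extensions and the restriction between them. -/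
theorem IsRestriction.exists_equiv (h : D.IsRestriction D' j)
    (h2 : Subsingleton (coh (D.fixedRep (D.J R)) 2))
    (h3 : Subsingleton (coh (D.fixedRep (D.J R)) 3))
    (h2' : Subsingleton (coh (D'.fixedRep (D'.J R)) 2))
    (h3' : Subsingleton (coh (D'.fixedRep (D'.J R)) 3))
    (e : E →* Multiplicative ℤ) [Finite e.ker] (e' : E' →* Multiplicative ℤ) [Finite e'.ker]
    (s : E) (hs : e s = Multiplicative.ofAdd 1) (s' : E') (hs' : e' s' = Multiplicative.ofAdd 1)
    (a : E) (ha : j (D'.σ s') = D.σ a) {A : ℕ} [NeZero A]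
    (c2 : Finite (coh (trivial R E R) 2)) (c3 : coh (trivial R E R) 3 ≃+ ZMod A)
    (c2' : Finite (coh (trivial R E' R) 2)) (c3' : Subsingleton (coh (trivial R E' R) 3)) :
    ∃ (φ : coh (trivial R G R) 3 ≃+ R × ZMod A) (ψ : coh (trivial R G' R) 3 ≃+ R),
      ∀ x, ψ (cohMap j (trivialMap R j) 3 x) = ((e a).toAdd : R) * (φ x).1 := by
  have hfin : Finite (coh (trivial R E R) 3) := Finite.of_equiv _ c3.symm.toEquiv
  let l := AddEquiv.ofBijective _ (D.bijective_lamAt_of_hom h2 h3 e s hs)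
  let l' := AddEquiv.ofBijective _ (D'.bijective_lamAt_of_hom h2' h3' e' s' hs')
  let B := AddEquiv.ofBijective _ (D.bijective_doubleDelta_add_inflation (R := R))
  have hB' : Function.Bijective (D'.doubleDelta R) := by
    have hfin' : Finite (coh (trivial R E' R) 3) := Finite.of_subsingleton
    have hb := D'.bijective_doubleDelta_add_inflation (R := R)
    constructor
    · intro x y hxy
      refine (Prod.ext_iff.1 (hb.1 (a₁ := (x, 0)) (a₂ := (y, 0)) ?_)).1
      rw [LinearMap.coprod_apply, LinearMap.coprod_apply, hxy]
    · intro y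
      obtain ⟨⟨x, z⟩, rfl⟩ := hb.2 y
      exact ⟨x, by rw [LinearMap.coprod_apply, Subsingleton.elim z 0, map_zero, add_zero]⟩
  let B' := AddEquiv.ofBijective _ hB'
  let ψ := B'.symm.trans l'
  refine ⟨B.symm.trans (AddEquiv.prodCongr l c3), ψ, fun y => ?_⟩
  obtain ⟨⟨x, z⟩, rfl⟩ := B.surjective y
  -- Inflated classes are killed by `A`, while the target `R` is torsion-free.
  have hz : ψ (cohMap j (trivialMap R j) 3 (D.inflation R 3 z)) = 0 := by
    have hA : A • z = 0 := c3.injective (by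
      rw [map_nsmul, map_zero, nsmul_eq_mul, ZMod.natCast_self, zero_mul])
    have h := congrArg (fun z => ψ (cohMap j (trivialMap R j) 3 (D.inflation R 3 z))) hA
    simp only [map_nsmul, map_zero] at h
    rw [nsmul_eq_mul, mul_eq_zero] at h
    exact h.resolve_left (Nat.cast_ne_zero.2 (NeZero.ne A))
  have hx : ψ (cohMap j (trivialMap R j) 3 (D.doubleDelta R x)) =
      D.lamAt R (D.σ a) x := by
    rw [h.cohMap_doubleDelta, ← ha, ← h.lamAt_cohMap]
    exact congrArg l' (B'.symm_apply_apply _)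
  have hBs : (B.symm.trans (AddEquiv.prodCongr l c3)) (B (x, z)) = (l x, c3 z) :=
    congrArg (AddEquiv.prodCongr l c3) (B.symm_apply_apply (x, z))
  rw [hBs]
  have hB : B (x, z) = D.doubleDelta R x + D.inflation R 3 z := LinearMap.coprod_apply _ _ _
  rw [hB, map_add, map_add, hz, hx, add_zero]
  exact additive_eq_mul e s hs (fun a => D.lamAt R (D.σ a) x)
    (fun a b => by rw [map_mul, lamAt_mul]) a

end Classification

end PlaneExtension

/-! ### Vanishing from a central element of order six -/

section Vanishing

variable {R : Type} [CommRing R] {G V : Type} [Group G] [AddCommGroup V] [Module R V]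

/-- If a central element acts as a primitive sixth root of unity, the cohomology vanishes. -/
theorem subsingleton_coh_of_central (ρ : Representation R G V) (c : G) (hc : ∀ g, g * c = c * g)
    (h : ∀ v, ρ (c * c) v + v = ρ c v) (n : ℕ) : Subsingleton (coh ρ n) := by
  refine subsingleton_of_forall_eq 0 fun x => ?_
  have hcc : ∀ g, g * (c * c) = c * c * g := fun g => by
    rw [← mul_assoc, hc, mul_assoc, hc, ← mul_assoc]
  have h1 := coeffMap_add (centralMap ρ (c * c) hcc) (IntertwiningMap.id ρ) n x
  have h2 : centralMap ρ (c * c) hcc + IntertwiningMap.id ρ = centralMap ρ c hc := by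
    ext v
    exact h v
  rw [h2, coeffMap_centralMap, coeffMap_centralMap, coeffMap, cohMap_id] at h1
  exact left_eq_add.1 h1

/-- This is Cayley–Hamilton. -/
theorem mul_self_eq_of_det_eq_one (M : Matrix (Fin 2) (Fin 2) ℤ) (hM : M.det = 1) :
    M * M = M.trace • M - 1 := by
  rw [Matrix.det_fin_two] at hM
  ext i j
  simp only [Matrix.mul_apply, Fin.sum_univ_two, Matrix.trace_fin_two, Matrix.sub_apply,
    Matrix.smul_apply, smul_eq_mul]
  fin_cases i <;> fin_cases j <;>
    simp only [Fin.zero_eta, Fin.mk_one, Matrix.one_apply_eq, ne_eq, zero_ne_one, one_ne_zero,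
      not_false_eq_true, Matrix.one_apply_ne] <;>
    first | linear_combination -hM | ring

/-- An integral matrix of order six is a root of the sixth cyclotomic polynomial. -/
theorem mul_self_add_one_of_order_six (M : Matrix (Fin 2) (Fin 2) ℤ) (hM : M.det = 1)
    (h2 : M ^ 2 ≠ 1) (h3 : M ^ 3 ≠ 1) (h6 : M ^ 6 = 1) : M * M + 1 = M := by
  have h := mul_self_eq_of_det_eq_one M hM
  set t := M.trace with ht
  have e3 : M ^ 3 = (t ^ 2 - 1) • M - t • 1 := by
    rw [pow_succ, pow_two, h, sub_mul, smul_mul_assoc, h, one_mul]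
    module
  have e6 : (t * (t ^ 2 - 1) * (t ^ 2 - 3)) • M + (t ^ 2 - (t ^ 2 - 1) ^ 2) • 1 = 1 := by
    have e : M ^ 6 = M ^ 3 * M ^ 3 := by rw [← pow_add]
    simp only [h6, e3, sub_mul, mul_sub, smul_mul_assoc, mul_smul_comm, one_mul, mul_one, h] at e
    refine Eq.trans ?_ e.symm
    module
  -- If the coefficient of `M` vanishes, then `t = 0` would give `-1 = 1`, `t = -1` would give `M ^
  -- 3 = 1`, and `t ^ 2 = 3` has no integral solution, so `t = 1`. If it does not vanish, `M` is
  -- scalar and `M ^ 2 = 1`.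
  by_cases hk : t * (t ^ 2 - 1) * (t ^ 2 - 3) = 0
  · rcases mul_eq_zero.1 hk with hk | hk
    · rcases mul_eq_zero.1 hk with hk | hk
      · rw [hk] at e6
        have := congrFun (congrFun e6 0) 0
        simp at this
      · rcases sq_eq_sq_iff_eq_or_eq_neg.1 ((sub_eq_zero.1 hk).trans (one_pow 2).symm) with hk | hk
        · rw [h, hk, one_smul, sub_add_cancel]
        · refine absurd ?_ h3
          rw [e3, hk]
          simp
    · exfalso
      have h1 : t < 2 := by nlinarith
      have h2 : -2 < t := by nlinarith
      interval_cases t <;> simp at hk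
  · have e : ∀ i j, (t * (t ^ 2 - 1) * (t ^ 2 - 3)) * M i j +
        (t ^ 2 - (t ^ 2 - 1) ^ 2) * (1 : Matrix (Fin 2) (Fin 2) ℤ) i j =
          (1 : Matrix (Fin 2) (Fin 2) ℤ) i j := fun i j => congrFun (congrFun e6 i) j
    have e01 : M 0 1 = 0 := (mul_eq_zero.1 (by simpa using e 0 1)).resolve_left hk
    have e10 : M 1 0 = 0 := (mul_eq_zero.1 (by simpa using e 1 0)).resolve_left hk
    have e00 := e 0 0
    have e11 := e 1 1
    simp only [Matrix.one_apply_eq] at e00 e11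
    have hd : M 0 0 = M 1 1 := mul_left_cancel₀ hk (by linear_combination e00 - e11)
    refine absurd ?_ h2
    rw [Matrix.det_fin_two, e01, hd] at hM
    ext i j
    fin_cases i <;> fin_cases j <;> simp [pow_two, Matrix.mul_apply, Fin.sum_univ_two, e01, e10, hd]
      <;>
      linear_combination hM

end Vanishing

namespace PlaneExtension

variable {R : Type} [CommRing R] {G E S : Type} [Group G] [CommGroup E]
  (D : PlaneExtension G E S)

/-- The translation invariant functions up to constants have no cohomology if an element of the
complement acts on the plane with order six. -/
theorem subsingleton_coh_fixedRep_J_of_order_six (c : E)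
    (hc : ∀ v, D.act (D.σ c)⁻¹ (D.act (D.σ c)⁻¹ v) + v = D.act (D.σ c)⁻¹ v) (n : ℕ) :
    Subsingleton (coh (D.fixedRep (D.J R)) n) := by
  refine subsingleton_coh_of_central _ c (fun g => mul_comm g c) (fun y => Fixed.ext ?_) n
  -- A translation invariant function up to constants is a homomorphism `ℤ² → R`, so the relation
  -- for `c` on vectors passes to it.
  have hy : ∀ v w, y.1.1 v w = y.1.1 0 (w - v) := fun v w => by
    have h := congrArg (fun y : PlaneDiff R => y.1 v w) (y.2 v)
    simp only [J_tr_apply, sub_self] at h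
    exact h.symm
  have hadd : ∀ v w, y.1.1 0 (v + w) = y.1.1 0 v + y.1.1 0 w := fun v w => by
    rw [← diff_add y.1 0 v, hy v, add_sub_cancel_left]
  refine Diff.ext fun v w => ?_
  change (D.J R (D.σ (c * c)) y.1).1 v w + y.1.1 v w = (D.J R (D.σ c) y.1).1 v w
  rw [map_mul, map_mul, Module.End.mul_apply, J_apply, J_apply, J_apply]
  refine (congrArg₂ (· + ·) (hy _ _) (hy v w)).trans
    ((hadd _ _).symm.trans (Eq.trans (congrArg (y.1.1 0) ?_) (hy _ _).symm))
  exact (sub_add_sub_comm _ _ _ _).trans (congrArg₂ (· - ·) (hc w) (hc v))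

end PlaneExtension

/-! ### The screw group and its lattice as plane extensions -/

open ScrewGroup

theorem mul_carry (n : ℕ) [NeZero n] (a b : ZMod n) :
    (n : ℤ) * carry n a b = a.val + b.val - (a + b).val := by
  have h := Nat.div_add_mod (a.val + b.val) n
  rw [← ZMod.val_add] at h
  have h' : (n : ℤ) * carry n a b + ((a + b).val : ℤ) = a.val + b.val := by
    unfold carry
    exact_mod_cast h
  linarith

variable {n A : ℕ} {ν : ZMod (n / A)}
  {ρ : Multiplicative (ZMod n) →* Matrix.SpecialLinearGroup (Fin 2) ℤ}

@[simp]
theorem axis_mul (x y : ScrewGroup n A ν ρ) :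
    (x * y).axis = x.axis + y.axis + carry n x.rot y.rot * (A * ν.val) := rfl

@[simp]
theorem plane_mul (x y : ScrewGroup n A ν ρ) :
    (x * y).plane = x.plane + ScrewGroup.act ρ x.rot y.plane := rfl

@[simp]
theorem rot_mul (x y : ScrewGroup n A ν ρ) : (x * y).rot = x.rot + y.rot := rfl

@[simp]
theorem axis_one : (1 : ScrewGroup n A ν ρ).axis = 0 := rfl

@[simp]
theorem plane_one : (1 : ScrewGroup n A ν ρ).plane = 0 := rfl

@[simp]
theorem rot_one : (1 : ScrewGroup n A ν ρ).rot = 0 := rfl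

@[simp]
theorem act_zero_right (a : ZMod n) : ScrewGroup.act ρ a 0 = 0 := by
  simp [ScrewGroup.act]

theorem planeDet_act (a : ZMod n) (t u : Fin 2 → ℤ) :
    planeDet (ScrewGroup.act ρ a t) (ScrewGroup.act ρ a u) = planeDet t u := by
  have h := (ρ (Multiplicative.ofAdd a)).2
  rw [Matrix.det_fin_two] at h
  simp only [planeDet, ScrewGroup.act, Matrix.mulVec, dotProduct, Fin.sum_univ_two]
  linear_combination (t 0 * u 1 - t 1 * u 0) * h

variable [NeZero n]

variable (n A ν ρ) in
/-- The screw motions and translations along the axis. -/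
def axisGroup : Subgroup (ScrewGroup n A ν ρ) where
  carrier := {x | x.plane = 0}
  mul_mem' {x y} hx hy := by
    change x.plane = 0 at hx
    change y.plane = 0 at hy
    change (x * y).plane = 0
    simp [hx, hy]
  one_mem' := rfl
  inv_mem' {x} hx := by
    change x.plane = 0 at hx
    change (x⁻¹).plane = 0
    simp [inv_def, hx]

instance : CommGroup (axisGroup n A ν ρ) :=
  { (inferInstance : Group (axisGroup n A ν ρ)) with
    mul_comm := fun x y => Subtype.ext (ScrewGroup.ext
      (by simp [carry_comm n x.1.rot y.1.rot, add_comm x.1.axis])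
      (by
        have hx : x.1.plane = 0 := x.2
        have hy : y.1.plane = 0 := y.2
        simp [hx, hy])
      (add_comm _ _)) }

/-- The affine action on the plane lattice. -/
def affineAct : ScrewGroup n A ν ρ →* Equiv.Perm (Fin 2 → ℤ) :=
  MonoidHom.toHomPerm
    { toFun := fun g v => g.plane + ScrewGroup.act ρ g.rot v
      map_one' := funext fun v => (zero_add _).trans (ScrewGroup.act_zero v)
      map_mul' := fun g h => funext fun v => by
        change (g * h).plane + ScrewGroup.act ρ (g * h).rot v =
          g.plane + ScrewGroup.act ρ g.rot (h.plane + ScrewGroup.act ρ h.rot v)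
        simp [ScrewGroup.act_add, act_vadd, add_assoc] }

theorem affineAct_apply (g : ScrewGroup n A ν ρ) (v : Fin 2 → ℤ) :
    affineAct g v = g.plane + ScrewGroup.act ρ g.rot v := rfl

variable (n A ν ρ) in
/-- The screw space group as an extension of its axis group by the translations of the plane. -/
def screwExtension : PlaneExtension (ScrewGroup n A ν ρ) (axisGroup n A ν ρ)
    (ScrewGroup n A ν ρ) where
  act := affineAct
  lin g := ScrewGroup.act ρ g.rot
  act_add g v w := by simp only [affineAct_apply, act_vadd, add_assoc]
  det_lin g := planeDet_act g.rot
  ι := (translation n A ν ρ).comp (AddMonoidHom.toMultiplicative (AddMonoidHom.inr ℤ (Fin 2 → ℤ)))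
  act_ι t v := by
    change t.toAdd + ScrewGroup.act ρ 0 v = _
    rw [ScrewGroup.act_zero]
  conj_ι g t := ScrewGroup.ext (by simp [translation, carry_zero_left, carry_zero_right])
    (by simp [translation, add_comm, ScrewGroup.act_zero]) (by simp [translation])
  σ := (axisGroup n A ν ρ).subtype
  act_σ e := by
    have he : e.1.plane = 0 := e.2
    simp [affineAct_apply, he]
  π :=
    { toFun := fun g => ⟨{ axis := g.axis, plane := 0, rot := g.rot }, rfl⟩
      map_one' := rfl
      map_mul' := fun g h => Subtype.ext (ScrewGroup.ext rfl (by simp) rfl) }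
  π_σ e := Subtype.ext (ScrewGroup.ext rfl (Eq.symm e.2) rfl)
  π_ι t := rfl
  ker_π g hg := by
    have h1 := congrArg (fun x => x.1.axis) hg
    have h2 := congrArg (fun x => x.1.rot) hg
    exact ⟨Multiplicative.ofAdd g.plane, ScrewGroup.ext h1 rfl h2⟩
  b := leftMul _
  free g s h := mul_eq_right.1 h
  s₀ := 1

variable (n A ν ρ) in
/-- The translation lattice as an extension of the axis translations by the translations of the
plane. -/
def latticeExtension : PlaneExtension (Multiplicative (ℤ × (Fin 2 → ℤ))) (Multiplicative ℤ)
    (ScrewGroup n A ν ρ) where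
  act := affineAct.comp (translation n A ν ρ)
  lin _ v := v
  act_add g v w := by
    change g.toAdd.2 + ScrewGroup.act ρ 0 (v + w) = g.toAdd.2 + ScrewGroup.act ρ 0 v + w
    rw [ScrewGroup.act_zero, ScrewGroup.act_zero, add_assoc]
  det_lin _ _ _ := rfl
  ι := AddMonoidHom.toMultiplicative (AddMonoidHom.inr ℤ (Fin 2 → ℤ))
  act_ι t v := by
    change t.toAdd + ScrewGroup.act ρ 0 v = _
    rw [ScrewGroup.act_zero]
  conj_ι g t := mul_comm _ _
  σ := AddMonoidHom.toMultiplicative (AddMonoidHom.inl ℤ (Fin 2 → ℤ))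
  act_σ e := by
    change 0 + ScrewGroup.act ρ 0 0 = _
    rw [act_zero_right, add_zero]
  π := AddMonoidHom.toMultiplicative (AddMonoidHom.fst ℤ (Fin 2 → ℤ))
  π_σ e := rfl
  π_ι t := rfl
  ker_π g hg := ⟨Multiplicative.ofAdd g.toAdd.2, Multiplicative.toAdd.injective
    (Prod.ext (congrArg Multiplicative.toAdd hg) rfl)⟩
  b := (leftMul _).comp (translation n A ν ρ)
  free g s h := by
    have h1 : translation n A ν ρ g = 1 := mul_eq_right.1 h
    exact Multiplicative.toAdd.injective (Prod.ext (congrArg ScrewGroup.axis h1)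
      (congrArg ScrewGroup.plane h1))
  s₀ := 1

/-- The lattice acts on the whole screw group as its free set, so all data agree by definition. -/
theorem isRestriction_latticeExtension :
    (screwExtension n A ν ρ).IsRestriction (latticeExtension n A ν ρ) (translation n A ν ρ) where
  act_eq _ := rfl
  b_eq _ := rfl
  ι_eq _ := rfl
  s₀_eq := rfl

/-- The homomorphism to `ℤ` that measures the motion along the axis in units of `1 / m`. -/
def axisHom (m : ℕ) (hm : m * (A * ν.val) = n) : axisGroup n A ν ρ →* Multiplicative ℤ :=
  MonoidHom.mk' (fun x => Multiplicative.ofAdd (m * x.1.axis + x.1.rot.val)) fun x y => by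
    refine Multiplicative.toAdd.injective ?_
    -- A carry adds `m * (A * ν.val) = n`, exactly what the residue loses by wrapping around.
    have h := mul_carry n x.1.rot y.1.rot
    have hm' : (m : ℤ) * (A * ν.val) = n := by exact_mod_cast hm
    change (m : ℤ) * (x.1.axis + y.1.axis + carry n x.1.rot y.1.rot * (A * ν.val)) +
      (x.1.rot + y.1.rot).val = (m * x.1.axis + x.1.rot.val) + (m * y.1.axis + y.1.rot.val)
    linear_combination h + carry n x.1.rot y.1.rot * hm'

theorem axisHom_apply (m : ℕ) (hm : m * (A * ν.val) = n) (x : axisGroup n A ν ρ) :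
    axisHom m hm x = Multiplicative.ofAdd ((m : ℤ) * x.1.axis + x.1.rot.val) := rfl

theorem injective_rot_ker_axisHom {m : ℕ} [NeZero m] (hm : m * (A * ν.val) = n) :
    Function.Injective fun x : (axisHom (ρ := ρ) m hm).ker => x.1.1.rot := by
  intro x y h
  have hx : (m : ℤ) * x.1.1.axis + x.1.1.rot.val = 0 := congrArg Multiplicative.toAdd x.2
  have hy : (m : ℤ) * y.1.1.axis + y.1.1.rot.val = 0 := congrArg Multiplicative.toAdd y.2
  have h' : x.1.1.rot = y.1.1.rot := h
  rw [h'] at hx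
  have hm0 : (m : ℤ) ≠ 0 := Nat.cast_ne_zero.2 (NeZero.ne m)
  refine Subtype.ext (Subtype.ext (ScrewGroup.ext (mul_left_cancel₀ hm0 ?_) ?_ h))
  · linear_combination hx - hy
  · exact Eq.trans x.1.2 (Eq.symm y.1.2)

theorem finite_ker_axisHom {m : ℕ} [NeZero m] (hm : m * (A * ν.val) = n) :
    Finite (axisHom (ρ := ρ) m hm).ker :=
  Finite.of_injective _ (injective_rot_ker_axisHom hm)

theorem isCyclic_ker_axisHom {m : ℕ} [NeZero m] (hm : m * (A * ν.val) = n) :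
    IsCyclic (axisHom (ρ := ρ) m hm).ker :=
  isCyclic_of_injective (G' := Multiplicative (ZMod n))
    (MonoidHom.mk' (fun x => Multiplicative.ofAdd x.1.1.rot) fun _ _ => rfl)
    fun _ _ h => injective_rot_ker_axisHom hm h

theorem card_ker_axisHom {m : ℕ} [NeZero m] (hm : m * (A * ν.val) = n) :
    Nat.card (axisHom (ρ := ρ) m hm).ker = A * ν.val := by
  have hval : ∀ i : Fin (A * ν.val), ((m * i : ℕ) : ZMod n).val = m * i := fun i =>
    ZMod.val_natCast_of_lt (by
      conv_rhs => rw [← hm]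
      exact Nat.mul_lt_mul_of_pos_left i.2 (NeZero.pos m))
  -- In the kernel the residue is `-m` times the axis coordinate, hence a multiple of `m` below `n =
  -- m * (A * ν.val)`.
  let f : Fin (A * ν.val) → (axisHom (ρ := ρ) m hm).ker := fun i =>
    ⟨⟨{ axis := -i, plane := 0, rot := ((m * i : ℕ) : ZMod n) }, rfl⟩, by
      rw [MonoidHom.mem_ker, axisHom_apply, hval]
      push_cast
      rw [mul_neg, neg_add_cancel, ofAdd_zero]⟩
  have hf : Function.Bijective f := by
    constructor
    · intro i k h
      have h1 : -((i : ℕ) : ℤ) = -((k : ℕ) : ℤ) := congrArg (fun x => x.1.1.axis) h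
      exact Fin.ext (by omega)
    · intro x
      have hx : (m : ℤ) * x.1.1.axis + x.1.1.rot.val = 0 := congrArg Multiplicative.toAdd x.2
      have hm0 : (0 : ℤ) < m := Nat.cast_pos.2 (NeZero.pos m)
      have h0 : 0 ≤ -x.1.1.axis := by nlinarith
      obtain ⟨i, hi⟩ := Int.eq_ofNat_of_zero_le h0
      have hi2 : x.1.1.rot.val = m * i := by
        zify
        linear_combination hx + (m : ℤ) * hi
      have hlt : i < A * ν.val := by
        have := ZMod.val_lt x.1.1.rot
        rw [hi2] at this
        conv_rhs at this => rw [← hm]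
        exact lt_of_mul_lt_mul_left this (Nat.zero_le m)
      refine ⟨⟨i, hlt⟩, injective_rot_ker_axisHom hm ?_⟩
      change ((m * i : ℕ) : ZMod n) = x.1.1.rot
      rw [← hi2, ZMod.natCast_zmod_val]
  rw [← Nat.card_eq_of_bijective f hf, Nat.card_fin]

variable (n A ν ρ) in
/-- The screw motion by the smallest angle. -/
def screwGenerator : axisGroup n A ν ρ := ⟨{ axis := 0, plane := 0, rot := 1 }, rfl⟩

theorem axisHom_screwGenerator (m : ℕ) (hm : m * (A * ν.val) = n) (hn : n ≠ 1) :
    axisHom m hm (screwGenerator n A ν ρ) = Multiplicative.ofAdd 1 := by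
  rw [axisHom_apply]
  simp [screwGenerator, ZMod.val_one'' hn]

theorem surjective_of_apply_eq_ofAdd_one {E : Type} [Group E] (e : E →* Multiplicative ℤ) (s : E)
    (hs : e s = Multiplicative.ofAdd 1) : Function.Surjective e := fun k =>
  ⟨s ^ k.toAdd, by
    rw [map_zpow, hs, ← ofAdd_zsmul, smul_eq_mul, mul_one]
    rfl⟩

theorem subsingleton_coh_fixedRep_J_screw_six (R : Type) [CommRing R] {ν : ZMod (6 / A)}
    {ρ : Multiplicative (ZMod 6) →* Matrix.SpecialLinearGroup (Fin 2) ℤ}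
    (hρ : Function.Injective ρ) (k : ℕ) :
    Subsingleton (coh ((screwExtension 6 A ν ρ).fixedRep ((screwExtension 6 A ν ρ).J R)) k) := by
  refine (screwExtension 6 A ν ρ).subsingleton_coh_fixedRep_J_of_order_six
    (screwGenerator 6 A ν ρ) (fun v => ?_) k
  -- The inverse rotation appears because functions transform through the inverse; it has order six
  -- since `ρ` is injective.
  let M := ρ (Multiplicative.ofAdd (-1))
  have hpow : ∀ i : ℕ, M.1 ^ i = 1 ↔ i • (-1 : ZMod 6) = 0 := by
    intro i
    rw [← Matrix.SpecialLinearGroup.coe_pow, ← Matrix.SpecialLinearGroup.coe_one, ← map_pow]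
    exact Subtype.ext_iff.symm.trans (map_eq_one_iff ρ hρ)
  have hM : M.1 * M.1 + 1 = M.1 := mul_self_add_one_of_order_six M.1 M.2
    (fun h => absurd ((hpow 2).1 h) (by decide)) (fun h => absurd ((hpow 3).1 h) (by decide))
    ((hpow 6).2 (by decide))
  have hact : ∀ v, (screwExtension 6 A ν ρ).act ((screwExtension 6 A ν ρ).σ
      (screwGenerator 6 A ν ρ))⁻¹ v = M.1.mulVec v := fun v => by
    change -ScrewGroup.act ρ (-1) 0 + M.1.mulVec v = _
    rw [act_zero_right, neg_zero, zero_add]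
  rw [hact, hact, Matrix.mulVec_mulVec]
  conv_rhs => rw [← hM, Matrix.add_mulVec, Matrix.one_mulVec]

/-! ### Assembly -/

/-- The third cohomology of a screw space group over a coefficient ring of characteristic zero,
given the cohomology of its axis group. -/
theorem exists_coh_three_equiv (R : Type) [CommRing R] [IsDomain R] [CharZero R] {n A : ℕ}
    [NeZero n] [NeZero A] {ν : ZMod (n / A)}
    {ρ : Multiplicative (ZMod n) →* Matrix.SpecialLinearGroup (Fin 2) ℤ}
    (hρ : Function.Injective ρ) (m : ℕ) [NeZero m] (hm : m * (A * ν.val) = n) (hn : n ≠ 1)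
    (hν : ν.val = 1) (hA : A = 1 ∨ n = 6)
    (c2 : Finite (coh (trivial R (axisGroup n A ν ρ) R) 2))
    (c3 : coh (trivial R (axisGroup n A ν ρ) R) 3 ≃+ ZMod A)
    (c2' : Finite (coh (trivial R (Multiplicative ℤ) R) 2))
    (c3' : Subsingleton (coh (trivial R (Multiplicative ℤ) R) 3)) :
    ∃ (φ : coh (trivial R (ScrewGroup n A ν ρ) R) 3 ≃+ R × ZMod A)
      (ψ : coh (trivial R (Multiplicative (ℤ × (Fin 2 → ℤ))) R) 3 ≃+ R),
      ∀ x, ψ (cohMap (translation n A ν ρ) (trivialMap R (translation n A ν ρ)) 3 x) =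
        (m : R) * (φ x).1 := by
  have hJ : ∀ k, Subsingleton (coh ((screwExtension n A ν ρ).fixedRep
      ((screwExtension n A ν ρ).J R)) (k + 2)) := by
    intro k
    -- For `A = 1` the axis group embeds in `ℤ` and has cohomological dimension one; for `n = 6` the
    -- central rotation kills the cohomology.
    rcases hA with hA | hA
    · refine subsingleton_coh_of_injective (axisHom m hm) ?_ _ k
      have := finite_ker_axisHom (ρ := ρ) hm
      rw [← MonoidHom.ker_eq_bot_iff, ← Subgroup.card_eq_one, card_ker_axisHom, hν, hA]
    · subst hA
      exact subsingleton_coh_fixedRep_J_screw_six R hρ _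
  have hJ' : ∀ k, Subsingleton (coh ((latticeExtension n A ν ρ).fixedRep
      ((latticeExtension n A ν ρ).J R)) (k + 2)) := fun k =>
    subsingleton_coh_of_injective (MonoidHom.id _) Function.injective_id _ k
  have := finite_ker_axisHom (ρ := ρ) hm
  have : Finite (MonoidHom.id (Multiplicative ℤ)).ker := by
    rw [MonoidHom.ker_id]
    infer_instance
  obtain ⟨φ, ψ, h⟩ := isRestriction_latticeExtension.exists_equiv (hJ 0) (hJ 1) (hJ' 0) (hJ' 1)
    (axisHom m hm) (MonoidHom.id _) (screwGenerator n A ν ρ) (axisHom_screwGenerator m hm hn)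
    -- The generator of the lattice's axis is `t₁`, on which `axisHom` takes the value `m`; this is
    -- the factor in the restriction map.
    (Multiplicative.ofAdd 1) rfl ⟨{ axis := 1, plane := 0, rot := 0 }, rfl⟩ rfl c2 c3 c2' c3'
  refine ⟨φ, ψ, fun x => (h x).trans ?_⟩
  rw [axisHom_apply]
  simp

/-- The multiples of a positive integer form an infinite cyclic group. -/
noncomputable def multiplesEquiv (m : ℕ) [NeZero m] : ℤ ≃+ AddSubgroup.zmultiples (m : ℤ) :=
  AddEquiv.ofBijective
    (AddMonoidHom.mk' (fun k : ℤ => (⟨m * k, Int.mem_zmultiples_iff.2 ⟨k, rfl⟩⟩ :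
      AddSubgroup.zmultiples (m : ℤ))) fun a b => Subtype.ext (mul_add _ _ _))
    ⟨fun a b h => mul_left_cancel₀ (Nat.cast_ne_zero.2 (NeZero.ne m)) (congrArg Subtype.val h),
      fun ⟨x, hx⟩ => by
        obtain ⟨k, rfl⟩ := Int.mem_zmultiples_iff.1 hx
        exact ⟨k, rfl⟩⟩

theorem exists_integralCohomology_equiv (n A : ℕ) [NeZero n]
    (hn : n = 2 ∨ n = 3 ∨ n = 4 ∨ n = 6) (hA : A ∣ n) (hcop : Nat.Coprime (n / A) A)
    (hν : (1 : ZMod (n / A)) ≠ 0)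
    (ρ : Multiplicative (ZMod n) →* Matrix.SpecialLinearGroup (Fin 2) ℤ)
    (hρ : Function.Injective ρ) :
    ∃ (φ : integralCohomology (ScrewGroup n A 1 ρ) 3 ≃+
          AddSubgroup.zmultiples ((n / A : ℕ) : ℤ) × ZMod A)
      (ψ : integralCohomology (Multiplicative (ℤ × (Fin 2 → ℤ))) 3 ≃+ ℤ),
      ∀ x, ψ (integralCohomologyMap (ScrewGroup.translation n A 1 ρ) 3 x) = ((φ x).1 : ℤ) := by
  have hm1 : n / A ≠ 1 := fun h => hν (by
    rw [h]
    exact Subsingleton.elim _ _)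
  have hval : (1 : ZMod (n / A)).val = 1 := ZMod.val_one'' hm1
  have hm : n / A * (A * (1 : ZMod (n / A)).val) = n := by
    rw [hval, mul_one, Nat.div_mul_cancel hA]
  have : NeZero A := ⟨fun h => NeZero.ne n (by rw [← hm, h, zero_mul, mul_zero])⟩
  have : NeZero (n / A) := ⟨fun h => NeZero.ne n (by rw [← hm, h, zero_mul])⟩
  have hn1 : n ≠ 1 := by omega
  -- For `n = 2, 3` only `A = 1` is a divisor other than `n`; for `n = 4` coprimality excludes `A =
  -- 2`.
  have hA6 : A = 1 ∨ n = 6 := by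
    have hle := Nat.le_of_dvd (NeZero.pos n) hA
    have hpos := NeZero.pos A
    rcases hn with rfl | rfl | rfl | rfl <;> interval_cases A <;> simp_all
  have := finite_ker_axisHom (ρ := ρ) hm
  have hcard : Nat.card (axisHom (ρ := ρ) (n / A) hm).ker = A := by
    rw [card_ker_axisHom, hval, mul_one]
  have he := surjective_of_apply_eq_ofAdd_one _ _ (axisHom_screwGenerator (ρ := ρ) _ hm hn1)
  obtain ⟨c2⟩ := nonempty_coh_two_equiv _ he (isCyclic_ker_axisHom hm)
  obtain ⟨c3⟩ := nonempty_coh_three_equiv _ he (isCyclic_ker_axisHom hm)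
  rw [hcard] at c2 c3
  -- For the lattice the complement is `ℤ` itself: the same computation with trivial kernel gives
  -- `ZMod 1` in degrees two and three.
  have hker : (MonoidHom.id (Multiplicative ℤ)).ker = ⊥ := MonoidHom.ker_id
  have hcard' : Nat.card (MonoidHom.id (Multiplicative ℤ)).ker = 1 := by rw
    [hker, Subgroup.card_bot]
  have : Finite (MonoidHom.id (Multiplicative ℤ)).ker := Nat.finite_of_card_ne_zero (by omega)
  have hcyc : IsCyclic (MonoidHom.id (Multiplicative ℤ)).ker := by
    rw [hker]
    infer_instance
  obtain ⟨d2⟩ := nonempty_coh_two_equiv (MonoidHom.id (Multiplicative ℤ)) Function.surjective_id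
    hcyc
  obtain ⟨d3⟩ := nonempty_coh_three_equiv (MonoidHom.id (Multiplicative ℤ)) Function.surjective_id
    hcyc
  rw [hcard'] at d2 d3
  obtain ⟨φ, ψ, h⟩ := exists_coh_three_equiv ℤ hρ (n / A) hm hn1 hval hA6
    (Finite.of_equiv _ c2.symm.toEquiv) c3 (Finite.of_equiv _ d2.symm.toEquiv)
    d3.injective.subsingleton
  exact ⟨φ.trans (AddEquiv.prodCongr (multiplesEquiv (n / A)) (AddEquiv.refl _)), ψ, h⟩

end ScrewCohomology

theorem mainTheorem9 (n A : ℕ) [NeZero n] (hn : n = 2 ∨ n = 3 ∨ n = 4 ∨ n = 6)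
    (hA : A ∣ n) (hcop : Nat.Coprime (n / A) A)
    (hν : (1 : ZMod (n / A)) ≠ 0)
    (ρ : Multiplicative (ZMod n) →* Matrix.SpecialLinearGroup (Fin 2) ℤ)
    (hρ : Function.Injective ρ) :
    (∃ (φ : integralCohomology (ScrewGroup n A 1 ρ) 3 ≃+
            AddSubgroup.zmultiples ((n / A : ℕ) : ℤ) × ZMod A)
        (ψ : integralCohomology (Multiplicative (ℤ × (Fin 2 → ℤ))) 3 ≃+ ℤ),
        ∀ x, ψ (integralCohomologyMap (ScrewGroup.translation n A 1 ρ) 3 x) = ((φ x).1 : ℤ)) ∧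
    (A = 1 →
      ∃ (φ : integralCohomology (ScrewGroup n A 1 ρ) 3 ≃+ AddSubgroup.zmultiples (n : ℤ))
        (ψ : integralCohomology (Multiplicative (ℤ × (Fin 2 → ℤ))) 3 ≃+ ℤ),
        ∀ x, ψ (integralCohomologyMap (ScrewGroup.translation n A 1 ρ) 3 x) = (φ x : ℤ)) := by
  obtain ⟨φ, ψ, h⟩ := ScrewCohomology.exists_integralCohomology_equiv n A hn hA hcop hν ρ hρ
  refine ⟨⟨φ, ψ, h⟩, fun h1 => ?_⟩
  subst h1
  exact ⟨(φ.trans AddEquiv.prodUnique).trans (AddEquiv.addSubgroupCongr (by rw [Nat.div_one])),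
    ψ, h⟩
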